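/- **Model.** There are $N$ tasks, $M$ agents and rounds $t=1,\dots,T$. For each task $i$ and agent $m$ there are a completion time $c_{im}(t)\in\{C_l,\dots,C_u\}$ (integers, $1\le C_l\le C_u$), a reward $r_{im}(t)\in[0,1]$ and a resource consumption $f_{im}(t)\in[0,1]$; all these random variables are independent, and their laws do not depend on $t$. Let $\bar f_{im}=\mathbb E f_{im}(t)$, and let $L_m\ge 0$ be the capacity of agent $m$. A possible assignment is a binary matrix $a\in\{0,1\}^{N\times M}$ with $\sum_m a_{im}\le 1$ for every $i$; $\mathcal A^0$ is the set of these. Let $\mathcal A$ be the set of feasible ones, i.e. those with $\sum_i\bar f_{im}a_{im}\le L_m$ for all $m$, and $\mathcal A^c=\mathcal A^0\setminus\mathcal A$. Put $\Delta^L_{am}=\max\{\sum_i\bar f_{im}a_{im}-L_m,0\}$, $\Delta^L_a=\sum_m\Delta^L_{am}$, and $\bar L=\max_{a\in\mathcal A}\sum_{i,m}a_{im}$; assume $\bar L\ge 1$. If $a(t)$ is the matrix of jobs started in round $t$, then $b_{im}(t)=\sum_{s<t}a_{im}(s)\mathbf 1[s+c_{im}(s)>t]$ is the matrix of jobs still running,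 and the violation penalty is $$V_T=\mathbb E\Big[\sum_{t=1}^T\sum_{m=1}^M\max\Big\{0,\ \sum_{i}\bar f_{im}\,(a_{im}(t)+b_{im}(t))-L_m\Big\}\Big].$$ **Algorithm.** Let $B=\lceil 90\,(C_u/C_l)\ln T\rceil$. *Initialization:* every agent executes every task $B$ times, in any order in which at each time at least one job is running and no task is given to two agents at once; let $t_1$ be the first round by which all these jobs are completed. Afterwards, at the beginning of round $t$, let $T_{im}(t)$ be the number of completed jobs of the pair $(i,m)$ and $T^f_{im}(t)$ the number of rounds before $t$ in which agent $m$ was executing task $i$. Let $\hat r_{im},\hat c_{im},V^c_{im}$ be the empirical mean reward, empirical mean completion time and empirical variance of the completion time over the completed jobs, and $\hat f_{im}$ the empirical mean consumption over the rounds of execution. Put $d^r_{im}=\sqrt{1.5\ln t/T_{im}}$, $d^c_{im}=\sqrt{3V^c_{im}\ln t/T_{im}}+9(C_u-C_l)\ln t/T_{im}$, $\hat q_{im}=\min\{1,\hat r_{im}+d^r_{im}\}/\max\{C_l,\hat c_{im}-d^c_{im}\}$, and $d^f_{am}=\sqrt{1.5\,\bar L^2\ln t/\min_{i:a_{im}=1}T^f_{im}}$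 ($0$ if $a$ gives agent $m$ no task). *Phase $s\ge1$* occupies the rounds $t_s,\dots,t_{s+1}-1$, where $t_{s+1}=t_s+C_l\min_{i,m}T_{im}(t_s)+2C_u$ with the minimum over all task–agent pairs. At $t=t_s$ let $\mathcal A^\dagger_s=\{a\in\mathcal A^0:\sum_i\hat f_{im}a_{im}-d^f_{am}\le L_m\ \forall m\}$. If $\mathcal A_s^\dagger\ne\emptyset$, an oracle returns $a'_s\in\mathcal A^\dagger_s$ with $(1+\alpha)\sum_{i,m}\hat q_{im}a'_{s,im}\ge\max_{a\in\mathcal A^\dagger_s}\sum_{i,m}\hat q_{im}a_{im}$, where $\alpha\ge0$ is fixed; otherwise $a'_s$ minimizes $\sum_m\max\{\sum_i\hat f_{im}a_{im}-d^f_{am},0\}$ over $\mathcal A^0$. In each round $t$ of the phase, $a(t)=a'_s-b(t)$ if $b(t)\le a'_s$ entrywise, and $a(t)=0$ otherwise. **Theorem.** There is a constant $K=K(N,M)>0$, depending only on $N$ and $M$, such that for every instance as above, every $\alpha\ge0$, every such initialization and oracle, and every $T>MNBC_u$, $$V_T\ \le\ K\Big(\frac{C_u^2}{C_l}\ln T+\max_{a\in\mathcal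 A^c}\frac{\bar L^2\ln T}{(\max_m\Delta^L_{am})^2}+\bar L\max_{a\in\mathcal A^c}\Delta^L_a\Big),$$ where a maximum over the empty set is $0$. In particular, for a fixed instance, $V_T=O(\ln T)$. -/

import Mathlib

open MeasureTheory ProbabilityTheory

noncomputable section

namespace TaskAssign

/-- A binary `N × M` assignment matrix, represented by the set of its entries equal to `1`:
`(i, m) ∈ a` means that task `i` is assigned to agent `m`. -/
abbrev Assignment (N M : ℕ) := Finset (Fin N × Fin M)

/-- The set `𝒜⁰` of possible assignments: each task is given to at most one agent. -/
def possible (N M : ℕ) : Finset (Assignment N M) :=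
  Finset.univ.filter fun a => ∀ i, (Finset.univ.filter fun m => (i, m) ∈ a).card ≤ 1

/-- Entry `(i, m)` of the binary matrix `a`, as a real number. -/
def entry {N M : ℕ} (a : Assignment N M) (i : Fin N) (m : Fin M) : ℝ :=
  if (i, m) ∈ a then 1 else 0

/-- A problem instance with `N` tasks and `M` agents: bounds on the completion times, capacities,
and for each task-agent pair the laws of completion time, reward and resource consumption. -/
structure Instance (N M : ℕ) where
  Cl : ℕ
  Cu : ℕ
  one_le_Cl : 1 ≤ Cl
  Cl_le_Cu : Cl ≤ Cu
  L : Fin M → ℝ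
  L_nonneg : ∀ m, 0 ≤ L m
  lawC : Fin N → Fin M → Measure ℕ
  lawR : Fin N → Fin M → Measure ℝ
  lawF : Fin N → Fin M → Measure ℝ
  lawC_prob : ∀ i m, IsProbabilityMeasure (lawC i m)
  lawR_prob : ∀ i m, IsProbabilityMeasure (lawR i m)
  lawF_prob : ∀ i m, IsProbabilityMeasure (lawF i m)
  lawC_supp : ∀ i m, lawC i m (Set.Icc Cl Cu)ᶜ = 0
  lawR_supp : ∀ i m, lawR i m (Set.Icc 0 1)ᶜ = 0
  lawF_supp : ∀ i m, lawF i m (Set.Icc 0 1)ᶜ = 0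

namespace Instance

variable {N M : ℕ} (I : Instance N M)

/-- The mean resource consumption `f̄ᵢₘ`. -/
def fbar (i : Fin N) (m : Fin M) : ℝ := ∫ x, x ∂(I.lawF i m)

/-- The violation gap `Δᴸₐₘ = max {∑ᵢ f̄ᵢₘ aᵢₘ - Lₘ, 0}`. -/
def gapAgent (a : Assignment N M) (m : Fin M) : ℝ :=
  max (∑ i, I.fbar i m * entry a i m - I.L m) 0

/-- The violation gap `Δᴸₐ = ∑ₘ Δᴸₐₘ`. -/
def gap (a : Assignment N M) : ℝ := ∑ m, I.gapAgent a m

/-- The set `𝒜` of feasible assignments: possible, and within capacity in expectation. -/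
def feasible : Finset (Assignment N M) :=
  (possible N M).filter fun a => ∀ m, ∑ i, I.fbar i m * entry a i m ≤ I.L m

/-- The set of infeasible (possible) assignments. -/
def infeasible : Finset (Assignment N M) := possible N M \ I.feasible

/-- `L̄`, the largest number of tasks in a feasible assignment. -/
def Lbar : ℕ := I.feasible.sup Finset.card

/-- `B = ⌈90 (C_u / C_l) ln T⌉`. -/
def B (T : ℕ) : ℕ := ⌈90 * ((I.Cu : ℝ) / I.Cl) * Real.log T⌉₊

end Instance

/-- A realisation of all completion times `cᵢₘ(t)`, rewards `rᵢₘ(t)` and resource consumptions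
`fᵢₘ(t)`. The completion time and reward of a job are those indexed by its starting round; the
consumption in round `t` of a running job is the one indexed by `t`. -/
structure Samples (N M : ℕ) where
  c : ℕ → Fin N → Fin M → ℕ
  r : ℕ → Fin N → Fin M → ℝ
  f : ℕ → Fin N → Fin M → ℝ

/-- All coordinates of a realisation, as one family of real numbers. -/
def Samples.coord {N M : ℕ} (S : Samples N M) : Fin 3 × ℕ × Fin N × Fin M → ℝ
  | (0, t, i, m) => (S.c t i m : ℝ)
  | (1, t, i, m) => S.r t i m
  | (2, t, i, m) => S.f t i m

/-- The random realisation `S` has the laws prescribed by the instance, and all its coordinates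
are independent (over rounds, tasks, agents, and the three kinds of quantities). -/
structure IsSampling {N M : ℕ} (I : Instance N M) {Ω : Type*} [MeasurableSpace Ω]
    (P : Measure Ω) (S : Ω → Samples N M) : Prop where
  measurable_c : ∀ t i m, Measurable fun ω => (S ω).c t i m
  measurable_r : ∀ t i m, Measurable fun ω => (S ω).r t i m
  measurable_f : ∀ t i m, Measurable fun ω => (S ω).f t i m
  law_c : ∀ t i m, P.map (fun ω => (S ω).c t i m) = I.lawC i m
  law_r : ∀ t i m, P.map (fun ω => (S ω).r t i m) = I.lawR i m
  law_f : ∀ t i m, P.map (fun ω => (S ω).f t i m) = I.lawF i m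
  indep : iIndepFun (fun k ω => (S ω).coord k) P

/-! Statistics at the beginning of round `t`. Rounds are numbered from `1`, and `A s` is the
set of jobs started in round `s`; only rounds before `t` are used. -/

section Statistics

variable {N M : ℕ} (S : Samples N M) (A : ℕ → Assignment N M) (t : ℕ)

/-- The assignment `b(t)` of the jobs that are started before round `t` and not completed:
a job started in round `s` occupies the rounds `s, …, s + c(s) - 1`. -/
def running : Assignment N M :=
  Finset.univ.filter fun p =>
    ((Finset.Ico 1 t).filter fun s => p ∈ A s ∧ t < s + S.c s p.1 p.2).Nonempty

/-- The number of jobs of the pair `p` started before round `t`. -/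
def started (p : Fin N × Fin M) : ℕ := ((Finset.Ico 1 t).filter fun s => p ∈ A s).card

/-- The starting rounds of the jobs of the pair `p` that are completed before round `t`. -/
def completedJobs (p : Fin N × Fin M) : Finset ℕ :=
  (Finset.Ico 1 t).filter fun s => p ∈ A s ∧ s + S.c s p.1 p.2 ≤ t

/-- `Tᵢₘ(t)`, the number of completed jobs. -/
def nJobs (p : Fin N × Fin M) : ℕ := (completedJobs S A t p).card

/-- The rounds before `t` in which the pair `p` was being executed. -/
def execRounds (p : Fin N × Fin M) : Finset ℕ :=
  (Finset.Ico 1 t).filter fun s => p ∈ A s ∪ running S A s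

/-- `Tᶠᵢₘ(t)`, the number of rounds of execution. -/
def nExec (p : Fin N × Fin M) : ℕ := (execRounds S A t p).card

/-- Empirical mean `r̂ᵢₘ(t)`. -/
def rhat (p : Fin N × Fin M) : ℝ :=
  (∑ s ∈ completedJobs S A t p, S.r s p.1 p.2) / nJobs S A t p

/-- Empirical mean `ĉᵢₘ(t)`. -/
def chat (p : Fin N × Fin M) : ℝ :=
  (∑ s ∈ completedJobs S A t p, (S.c s p.1 p.2 : ℝ)) / nJobs S A t p

/-- Empirical variance `Vᶜᵢₘ(t)`. -/
def cvar (p : Fin N × Fin M) : ℝ :=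
  (∑ s ∈ completedJobs S A t p, ((S.c s p.1 p.2 : ℝ) - chat S A t p) ^ 2) / nJobs S A t p

/-- Empirical mean `f̂ᵢₘ(t)`. -/
def fhat (p : Fin N × Fin M) : ℝ :=
  (∑ s ∈ execRounds S A t p, S.f s p.1 p.2) / nExec S A t p

variable (I : Instance N M)

/-- `dʳᵢₘ(t) = √(1.5 ln t / Tᵢₘ(t))`. -/
def radR (p : Fin N × Fin M) : ℝ := Real.sqrt (1.5 * Real.log t / nJobs S A t p)

/-- `dᶜᵢₘ(t) = √(3 Vᶜᵢₘ(t) ln t / Tᵢₘ(t)) + 9 (C_u - C_l) ln t / Tᵢₘ(t)`. -/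
def radC (p : Fin N × Fin M) : ℝ :=
  Real.sqrt (3 * cvar S A t p * Real.log t / nJobs S A t p)
    + 9 * ((I.Cu : ℝ) - I.Cl) * Real.log t / nJobs S A t p

/-- The optimistic estimate `q̂ᵢₘ(t)` of the per-round reward. -/
def qhat (i : Fin N) (m : Fin M) : ℝ :=
  min 1 (rhat S A t (i, m) + radR S A t (i, m))
    / max (I.Cl : ℝ) (chat S A t (i, m) - radC S A t I (i, m))

/-- `dᶠₐₘ(t) = √(1.5 L̄² ln t / min {Tᶠᵢₘ(t) : aᵢₘ = 1})`, which is `0` if `a` gives agent `m`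
no task. -/
def radF (a : Assignment N M) (m : Fin M) : ℝ :=
  if ∃ i, (i, m) ∈ a then
    Real.sqrt (1.5 * (I.Lbar : ℝ) ^ 2 * Real.log t
      / ((⨅ i : {i : Fin N // (i, m) ∈ a}, nExec S A t (i.1, m) : ℕ) : ℝ))
  else 0

/-- The lower confidence bound `∑ᵢ f̂ᵢₘ(t) aᵢₘ - dᶠₐₘ(t)`. -/
def lcb (a : Assignment N M) (m : Fin M) : ℝ :=
  ∑ i, fhat S A t (i, m) * entry a i m - radF S A t I a m

/-- The estimated set `𝒜†` of feasible assignments. -/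
def estFeasible : Finset (Assignment N M) :=
  (possible N M).filter fun a => ∀ m, lcb S A t I a m ≤ I.L m

/-- The phase length `C_l min Tᵢₘ(t) + 2 C_u`, the minimum being over all task-agent pairs. -/
def phaseLength : ℕ := I.Cl * (⨅ p, nJobs S A t p) + 2 * I.Cu

end Statistics

/-- `Σ(q ⊙ a)`. -/
def value {N M : ℕ} (q : Fin N → Fin M → ℝ) (a : Assignment N M) : ℝ :=
  ∑ i, ∑ m, q i m * entry a i m

/-- The parts of the algorithm that its description leaves open: how the initial jobs are
scheduled (given the numbers of jobs already started and the running jobs), the optimisation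
oracle (given the objective and the set of admissible assignments), and the choice of a minimiser
when no assignment looks feasible. -/
structure Routines (N M : ℕ) where
  init : (Fin N × Fin M → ℕ) → Assignment N M → Assignment N M
  oracle : (Fin N → Fin M → ℝ) → Finset (Assignment N M) → Assignment N M
  fallback : (Assignment N M → ℝ) → Assignment N M

/-- The initial schedule starts possible jobs, at most `B` of each pair, and never idles before
all of them are started. The oracle is `(1 + α)`-approximate (exact for `α = 0`); the fallback
returns a minimiser; both depend measurably on their objective. -/
structure Routines.Valid {N M : ℕ} (R : Routines N M) (B : ℕ) (α : ℝ) : Prop where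
  init_possible : ∀ n : Fin N × Fin M → ℕ, ∀ b ∈ possible N M,
    Disjoint (R.init n b) b ∧ R.init n b ∪ b ∈ possible N M
  init_le : ∀ n : Fin N × Fin M → ℕ, ∀ b ∈ possible N M, ∀ p ∈ R.init n b, n p < B
  init_nonidle : ∀ n : Fin N × Fin M → ℕ, (∃ p : Fin N × Fin M, n p < B) → (R.init n ∅).Nonempty
  oracle_mem : ∀ (q : Fin N → Fin M → ℝ) (F : Finset (Assignment N M)), F.Nonempty → R.oracle q F ∈ F
  oracle_approx : ∀ (q : Fin N → Fin M → ℝ) (F : Finset (Assignment N M)),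
    (∀ i m, 0 ≤ q i m) → ∀ a ∈ F,
      value q a ≤ (1 + α) * value q (R.oracle q F)
  oracle_measurable : ∀ (F : Finset (Assignment N M)) (a : Assignment N M),
    MeasurableSet {q : Fin N → Fin M → ℝ | R.oracle q F = a}
  fallback_mem : ∀ g : Assignment N M → ℝ, R.fallback g ∈ possible N M
  fallback_min : ∀ g : Assignment N M → ℝ, ∀ a ∈ possible N M, g (R.fallback g) ≤ g a
  fallback_measurable : ∀ a : Assignment N M,
    MeasurableSet {g : Assignment N M → ℝ | R.fallback g = a}

/-- The memory of the algorithm between two rounds: the assignments made so far, the assignment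
`a'ₛ` of the current phase, and the round in which the next phase is to begin. -/
structure State (N M : ℕ) where
  past : ℕ → Assignment N M
  plan : Assignment N M
  nextPhase : ℕ

section Algorithm

variable {N M : ℕ} (I : Instance N M) (R : Routines N M) (T : ℕ) (S : Samples N M)

/-- The assignment `a'ₛ` selected at the beginning `t = tₛ` of a phase. -/
def choosePlan (A : ℕ → Assignment N M) (t : ℕ) : Assignment N M :=
  if (estFeasible S A t I).Nonempty then
    R.oracle (qhat S A t I) (estFeasible S A t I)
  else
    R.fallback fun a => ∑ m, max (lcb S A t I a m) 0

/-- Round `t` of the algorithm run with horizon `T`. As long as some pair has completed fewer than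
`B` jobs, the round belongs to the initialisation. Otherwise a new phase begins if the previous one
is over, and the assignment is `a'ₛ - b(t)` if `b(t) ≤ a'ₛ`, and zero if not. -/
def step (t : ℕ) (σ : State N M) : State N M :=
  if ∃ p, nJobs S σ.past t p < I.B T then
    { past := Function.update σ.past t (R.init (started σ.past t) (running S σ.past t))
      plan := ∅
      nextPhase := t + 1 }
  else
    let newPhase : Prop := σ.nextPhase ≤ t
    let plan := open Classical in if newPhase then choosePlan I R S σ.past t else σ.plan
    let next := open Classical in
      if newPhase then t + phaseLength S σ.past t I else σ.nextPhase
    let b := running S σ.past t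
    { past := Function.update σ.past t (if b ⊆ plan then plan \ b else ∅)
      plan := plan
      nextPhase := next }

/-- The state of the algorithm after the rounds `1, …, t`. -/
def stateAfter : ℕ → State N M
  | 0 => { past := fun _ => ∅, plan := ∅, nextPhase := 1 }
  | t + 1 => step I R T S (t + 1) (stateAfter t)

/-- The assignment `a(t)` made by the algorithm in round `t`. -/
def assign (t : ℕ) : Assignment N M := (stateAfter I R T S t).past t

/-- The total excess `∑ₜ ∑ₘ max {0, ∑ᵢ f̄ᵢₘ (aᵢₘ(t) + bᵢₘ(t)) - Lₘ}` over the rounds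
`1, …, T` along a realisation. -/
def totalExcess : ℝ :=
  ∑ t ∈ Finset.Icc 1 T, ∑ m, max 0
    (∑ i, I.fbar i m * (entry (assign I R T S t) i m
      + entry (running S (assign I R T S) t) i m) - I.L m)

end Algorithm

/-- The violation penalty `V_T` of the algorithm. -/
def violationPenalty {N M : ℕ} (I : Instance N M) (R : Routines N M) (T : ℕ)
    {Ω : Type*} [MeasurableSpace Ω] (P : Measure Ω) (S : Ω → Samples N M) : ℝ :=
  ∫ ω, totalExcess I R T (S ω) ∂P

end TaskAssign

end

open TaskAssign

open MeasureTheory ProbabilityTheory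

noncomputable section

namespace TaskAssign

/-! ### Causality: everything done in round `t` depends only on earlier rounds -/

section Congruence

variable {N M : ℕ} {S S' : Samples N M} {A A' : ℕ → Assignment N M} {t : ℕ}

/-! The excess of a round is charged to the initialization, to an infeasible plan chosen with good
estimates, or to one chosen with bad estimates.

Initialization: some job is active in each of its rounds, at most `N M B` jobs are started and each
lasts at most `C_u` rounds. So it has at most `N M B C_u` rounds (`card_isInit_le`), each of excess
at most `N`, and `B C_u` is of order `(C_u² / C_l) ln T` up to an additive `C_u`.

Transitions: afterwards the active jobs lie in the current plan or, during the first `C_u` rounds of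
a phase, in the previous one. Phases last at least `2 C_u` rounds, so in the second case the
previous plan was in force in round `t - C_u`. Hence the total excess is at most twice the sum of
the gaps of the plans, plus the cost of the initialization (`totalExcess_le`). It remains to count
the rounds with an infeasible plan.

Good estimates: every plan passes the optimistic feasibility test. If it is infeasible although no
mean consumption is underestimated, then its largest agent gap `D` is at most a multiple of the
confidence width, so some pair of the plan has been executed only `O(L̄² ln T / D²)` times
(`exists_nExec_le`). Planning a pair makes it run, and a phase exceeds the number of past executions
of any pair by at most `2 C_u`. Each pair can therefore be blamed in few rounds
(`card_rare_rounds_le`).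

Bad estimates: a given pair is underestimated at round `φ` with probability at most `φ⁻²`
(`measure_underestimated_le`), while a phase starting at `φ` lasts at most `φ + 2 C_u` rounds. The
expected loss is `O(ln T + C_u)`. The number of observations is random and chosen adaptively, but
whether a pair is executed in round `s` is decided by the samples before `s`, which are independent
of the consumption in round `s`. This yields an exponential supermartingale, and a union bound over
the possible numbers of observations.

For `T ≥ 2` the first two terms of the bound absorb everything; the third term serves `T = 1`, where
`ln T = 0`. -/

theorem running_congr (hc : ∀ s ∈ Finset.Ico 1 t, S.c s = S'.c s)
    (hA : ∀ s ∈ Finset.Ico 1 t, A s = A' s) : running S A t = running S' A' t := by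
  unfold running
  refine Finset.filter_congr fun p _ => ?_
  rw [Finset.filter_congr (q := fun s => p ∈ A' s ∧ t < s + S'.c s p.1 p.2)]
  intro s hs
  rw [hc s hs, hA s hs]

theorem started_congr (hA : ∀ s ∈ Finset.Ico 1 t, A s = A' s) : started A t = started A' t := by
  funext p
  unfold started
  rw [Finset.filter_congr (q := fun s => p ∈ A' s)]
  intro s hs
  rw [hA s hs]

theorem completedJobs_congr (hc : ∀ s ∈ Finset.Ico 1 t, S.c s = S'.c s)
    (hA : ∀ s ∈ Finset.Ico 1 t, A s = A' s) : completedJobs S A t = completedJobs S' A' t := by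
  funext p
  unfold completedJobs
  refine Finset.filter_congr fun s hs => ?_
  rw [hc s hs, hA s hs]

theorem nJobs_congr (hc : ∀ s ∈ Finset.Ico 1 t, S.c s = S'.c s)
    (hA : ∀ s ∈ Finset.Ico 1 t, A s = A' s) : nJobs S A t = nJobs S' A' t := by
  funext p
  unfold nJobs
  rw [completedJobs_congr hc hA]

theorem execRounds_congr (hc : ∀ s ∈ Finset.Ico 1 t, S.c s = S'.c s)
    (hA : ∀ s ∈ Finset.Ico 1 t, A s = A' s) : execRounds S A t = execRounds S' A' t := by
  funext p
  unfold execRounds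
  refine Finset.filter_congr fun s hs => ?_
  have hsub : ∀ u ∈ Finset.Ico 1 s, u ∈ Finset.Ico 1 t := fun u hu => by
    simp only [Finset.mem_Ico] at hs hu ⊢; omega
  rw [running_congr (fun u hu => hc u (hsub u hu)) (fun u hu => hA u (hsub u hu)), hA s hs]

theorem nExec_congr (hc : ∀ s ∈ Finset.Ico 1 t, S.c s = S'.c s)
    (hA : ∀ s ∈ Finset.Ico 1 t, A s = A' s) : nExec S A t = nExec S' A' t := by
  funext p
  unfold nExec
  rw [execRounds_congr hc hA]

theorem completedJobs_subset (S : Samples N M) (A : ℕ → Assignment N M) (t : ℕ)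
    (p : Fin N × Fin M) : completedJobs S A t p ⊆ Finset.Ico 1 t := Finset.filter_subset _ _

theorem execRounds_subset (S : Samples N M) (A : ℕ → Assignment N M) (t : ℕ)
    (p : Fin N × Fin M) : execRounds S A t p ⊆ Finset.Ico 1 t := Finset.filter_subset _ _

theorem rhat_congr (hc : ∀ s ∈ Finset.Ico 1 t, S.c s = S'.c s)
    (hr : ∀ s ∈ Finset.Ico 1 t, S.r s = S'.r s)
    (hA : ∀ s ∈ Finset.Ico 1 t, A s = A' s) : rhat S A t = rhat S' A' t := by
  funext p
  unfold rhat
  rw [nJobs_congr hc hA, completedJobs_congr hc hA]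
  congr 1
  exact Finset.sum_congr rfl fun s hs => by rw [hr s (completedJobs_subset _ _ _ _ hs)]

theorem chat_congr (hc : ∀ s ∈ Finset.Ico 1 t, S.c s = S'.c s)
    (hA : ∀ s ∈ Finset.Ico 1 t, A s = A' s) : chat S A t = chat S' A' t := by
  funext p
  unfold chat
  rw [nJobs_congr hc hA, completedJobs_congr hc hA]
  congr 1
  exact Finset.sum_congr rfl fun s hs => by rw [hc s (completedJobs_subset _ _ _ _ hs)]

theorem cvar_congr (hc : ∀ s ∈ Finset.Ico 1 t, S.c s = S'.c s)
    (hA : ∀ s ∈ Finset.Ico 1 t, A s = A' s) : cvar S A t = cvar S' A' t := by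
  funext p
  unfold cvar
  rw [nJobs_congr hc hA, completedJobs_congr hc hA, chat_congr hc hA]
  congr 1
  exact Finset.sum_congr rfl fun s hs => by rw [hc s (completedJobs_subset _ _ _ _ hs)]

theorem fhat_congr (hc : ∀ s ∈ Finset.Ico 1 t, S.c s = S'.c s)
    (hf : ∀ s ∈ Finset.Ico 1 t, S.f s = S'.f s)
    (hA : ∀ s ∈ Finset.Ico 1 t, A s = A' s) : fhat S A t = fhat S' A' t := by
  funext p
  unfold fhat
  rw [nExec_congr hc hA, execRounds_congr hc hA]
  congr 1
  exact Finset.sum_congr rfl fun s hs => by rw [hf s (execRounds_subset _ _ _ _ hs)]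

variable (I : Instance N M)

theorem qhat_congr (hc : ∀ s ∈ Finset.Ico 1 t, S.c s = S'.c s)
    (hr : ∀ s ∈ Finset.Ico 1 t, S.r s = S'.r s)
    (hA : ∀ s ∈ Finset.Ico 1 t, A s = A' s) : qhat S A t I = qhat S' A' t I := by
  funext i m
  unfold qhat radR radC
  rw [rhat_congr hc hr hA, chat_congr hc hA, cvar_congr hc hA, nJobs_congr hc hA]

theorem lcb_congr (hc : ∀ s ∈ Finset.Ico 1 t, S.c s = S'.c s)
    (hf : ∀ s ∈ Finset.Ico 1 t, S.f s = S'.f s)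
    (hA : ∀ s ∈ Finset.Ico 1 t, A s = A' s) : lcb S A t I = lcb S' A' t I := by
  funext a m
  unfold lcb radF
  rw [fhat_congr hc hf hA, nExec_congr hc hA]

theorem estFeasible_congr (hc : ∀ s ∈ Finset.Ico 1 t, S.c s = S'.c s)
    (hf : ∀ s ∈ Finset.Ico 1 t, S.f s = S'.f s)
    (hA : ∀ s ∈ Finset.Ico 1 t, A s = A' s) : estFeasible S A t I = estFeasible S' A' t I := by
  unfold estFeasible
  rw [lcb_congr I hc hf hA]

theorem choosePlan_congr (R : Routines N M) (hc : ∀ s ∈ Finset.Ico 1 t, S.c s = S'.c s)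
    (hr : ∀ s ∈ Finset.Ico 1 t, S.r s = S'.r s)
    (hf : ∀ s ∈ Finset.Ico 1 t, S.f s = S'.f s)
    (hA : ∀ s ∈ Finset.Ico 1 t, A s = A' s) :
    choosePlan I R S A t = choosePlan I R S' A' t := by
  unfold choosePlan
  rw [estFeasible_congr I hc hf hA, qhat_congr I hc hr hA, lcb_congr I hc hf hA]

theorem phaseLength_congr (hc : ∀ s ∈ Finset.Ico 1 t, S.c s = S'.c s)
    (hA : ∀ s ∈ Finset.Ico 1 t, A s = A' s) : phaseLength S A t I = phaseLength S' A' t I := by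
  unfold phaseLength
  rw [nJobs_congr hc hA]

/-- The assignment of round `t`, the plan and the end of the phase produced by a round of the
algorithm depend only on the data of the rounds before `t`. -/
theorem step_congr (R : Routines N M) (T : ℕ) {σ σ' : State N M}
    (hc : ∀ s ∈ Finset.Ico 1 t, S.c s = S'.c s)
    (hr : ∀ s ∈ Finset.Ico 1 t, S.r s = S'.r s)
    (hf : ∀ s ∈ Finset.Ico 1 t, S.f s = S'.f s)
    (hA : ∀ s ∈ Finset.Ico 1 t, σ.past s = σ'.past s)
    (hp : σ.plan = σ'.plan) (hn : σ.nextPhase = σ'.nextPhase) :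
    (step I R T S t σ).past t = (step I R T S' t σ').past t ∧
      (step I R T S t σ).plan = (step I R T S' t σ').plan ∧
      (step I R T S t σ).nextPhase = (step I R T S' t σ').nextPhase := by
  unfold step
  rw [nJobs_congr hc hA, running_congr hc hA, started_congr hA,
    choosePlan_congr I R hc hr hf hA, phaseLength_congr I hc hA, hp, hn]
  split_ifs <;> simp

end Congruence

/-! ### Unfolding the recursion of the algorithm -/

section Recursion

variable {N M : ℕ} (I : Instance N M) (R : Routines N M) (T : ℕ) (S : Samples N M)

/-- The plan in force in round `t`. -/
def planAt (t : ℕ) : Assignment N M := (stateAfter I R T S t).plan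

/-- The beginning of the next phase, as scheduled after round `t`. -/
def nextAt (t : ℕ) : ℕ := (stateAfter I R T S t).nextPhase

/-- Round `t` belongs to the initialisation. -/
def IsInit (t : ℕ) : Prop := ∃ p, nJobs S (assign I R T S) t p < I.B T

/-- Round `t` is the first round of a phase. -/
def NewPhase (t : ℕ) : Prop := nextAt I R T S (t - 1) ≤ t

/-- A round overwrites only its own entry of `past`. So the stored history can be replaced by the
single sequence `assign` in all later arguments. -/
theorem stateAfter_past_succ {s t : ℕ} (hst : s ≤ t) :
    (stateAfter I R T S (t + 1)).past s = (stateAfter I R T S t).past s := by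
  have : s ≠ t + 1 := by omega
  simp only [stateAfter, step]
  split_ifs <;> simp [Function.update_of_ne this]

theorem stateAfter_past {s t : ℕ} (hst : s ≤ t) :
    (stateAfter I R T S t).past s = assign I R T S s := by
  induction t, hst using Nat.le_induction with
  | base => rfl
  | succ t ht ih => rw [stateAfter_past_succ I R T S ht, ih]

theorem stateAfter_past_Ico {t : ℕ} :
    ∀ s ∈ Finset.Ico 1 (t + 1), (stateAfter I R T S t).past s = assign I R T S s := by
  intro s hs
  exact stateAfter_past I R T S (by simp at hs; omega)

theorem round_init {t : ℕ} (ht : 1 ≤ t) (h : IsInit I R T S t) :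
    assign I R T S t
        = R.init (started (assign I R T S) t) (running S (assign I R T S) t) ∧
      planAt I R T S t = ∅ ∧ nextAt I R T S t = t + 1 := by
  obtain ⟨t, rfl⟩ : ∃ u, t = u + 1 := ⟨t - 1, by omega⟩
  have hA := stateAfter_past_Ico I R T S (t := t)
  have h' : ∃ p, nJobs S (stateAfter I R T S t).past (t + 1) p < I.B T := by
    rwa [nJobs_congr (fun _ _ => rfl) hA]
  simp only [assign, planAt, nextAt, stateAfter, step, if_pos h', Function.update_self, and_true]
  rw [running_congr (fun _ _ => rfl) hA, started_congr hA]

theorem round_run {t : ℕ} (ht : 1 ≤ t) (h : ¬ IsInit I R T S t) :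
    assign I R T S t = if running S (assign I R T S) t ⊆ planAt I R T S t then
      planAt I R T S t \ running S (assign I R T S) t else ∅ := by
  obtain ⟨t, rfl⟩ : ∃ u, t = u + 1 := ⟨t - 1, by omega⟩
  have hA := stateAfter_past_Ico I R T S (t := t)
  have h' : ¬ ∃ p, nJobs S (stateAfter I R T S t).past (t + 1) p < I.B T := by
    rwa [nJobs_congr (fun _ _ => rfl) hA]
  rw [← running_congr (S := S) (fun _ _ => rfl) hA]
  simp only [assign, planAt, stateAfter, step, if_neg h', Function.update_self]

theorem round_newPhase {t : ℕ} (ht : 1 ≤ t) (h : ¬ IsInit I R T S t) (hn : NewPhase I R T S t) :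
    planAt I R T S t = choosePlan I R S (assign I R T S) t ∧
      nextAt I R T S t = t + phaseLength S (assign I R T S) t I := by
  obtain ⟨t, rfl⟩ : ∃ u, t = u + 1 := ⟨t - 1, by omega⟩
  have hA := stateAfter_past_Ico I R T S (t := t)
  have h' : ¬ ∃ p, nJobs S (stateAfter I R T S t).past (t + 1) p < I.B T := by
    rwa [nJobs_congr (fun _ _ => rfl) hA]
  have hn' : (stateAfter I R T S t).nextPhase ≤ t + 1 := hn
  rw [← choosePlan_congr (S := S) I R (fun _ _ => rfl) (fun _ _ => rfl) (fun _ _ => rfl) hA,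
    ← phaseLength_congr (S := S) I (fun _ _ => rfl) hA]
  simp only [planAt, nextAt, stateAfter, step, if_neg h', if_pos hn', and_self]

theorem round_samePhase {t : ℕ} (ht : 1 ≤ t) (h : ¬ IsInit I R T S t)
    (hn : ¬ NewPhase I R T S t) :
    planAt I R T S t = planAt I R T S (t - 1) ∧ nextAt I R T S t = nextAt I R T S (t - 1) := by
  obtain ⟨t, rfl⟩ : ∃ u, t = u + 1 := ⟨t - 1, by omega⟩
  have hA := stateAfter_past_Ico I R T S (t := t)
  have h' : ¬ ∃ p, nJobs S (stateAfter I R T S t).past (t + 1) p < I.B T := by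
    rwa [nJobs_congr (fun _ _ => rfl) hA]
  have hn' : ¬ (stateAfter I R T S t).nextPhase ≤ t + 1 := hn
  simp only [planAt, nextAt, stateAfter, step, if_neg h', if_neg hn', add_tsub_cancel_right,
    and_self]

end Recursion

/-! ### Measurability of the algorithm with respect to past samples -/

section Measurability

instance finsetMeasurableSpace {α : Type*} : MeasurableSpace (Finset α) := ⊤

instance finsetDiscreteMeasurableSpace {α : Type*} : DiscreteMeasurableSpace (Finset α) :=
  ⟨fun _ => trivial⟩

theorem measurable_of_forall_eq {Ω γ : Type*} [MeasurableSpace Ω] [MeasurableSpace γ]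
    {g h : Ω → γ} (hg : Measurable g) (he : ∀ ω, h ω = g ω) : Measurable h := by
  rwa [show h = g from funext he]

/-- Assignments and completion times take countably many values, so they can be frozen while the
real-valued rewards and consumptions stay random. -/
theorem measurable_of_countable_dependence {Ω δ γ : Type*} [MeasurableSpace Ω]
    [MeasurableSpace δ] [Countable δ] [MeasurableSingletonClass δ] [MeasurableSpace γ]
    {g : Ω → δ → γ} {d : Ω → δ} (hd : Measurable d) (hg : ∀ x, Measurable fun ω => g ω x) :
    Measurable fun ω => g ω (d ω) :=
  (measurable_from_prod_countable_left (f := fun q : Ω × δ => g q.1 q.2) hg).comp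
    (measurable_id.prodMk hd)

theorem measurable_finset_filter {Ω α : Type*} [MeasurableSpace Ω] [Finite α] (s : Finset α)
    (p : Ω → α → Prop) [∀ ω, DecidablePred (p ω)] (hp : ∀ a, MeasurableSet {ω | p ω a}) :
    Measurable fun ω => s.filter (p ω) := by
  refine measurable_to_countable' fun F => ?_
  have : (fun ω => s.filter (p ω)) ⁻¹' {F} = ⋂ a, {ω | (a ∈ s ∧ p ω a) ↔ a ∈ F} := by
    ext ω
    simp [Finset.ext_iff]
  rw [this]
  refine MeasurableSet.iInter fun a => ?_
  by_cases hs : a ∈ s <;> by_cases hF : a ∈ F <;> simp only [hs, hF, true_and, false_and,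
    iff_true, iff_false, Set.ofPred_true, Set.ofPred_false]
  · exact hp a
  · exact (hp a).compl
  · exact MeasurableSet.empty
  · exact MeasurableSet.univ

variable {N M : ℕ} {Ω : Type*} [MeasurableSpace Ω] (I : Instance N M) (R : Routines N M) (T : ℕ)

section FixedHistory

variable {t : ℕ} (c : ℕ → Fin N → Fin M → ℕ) (A : ℕ → Assignment N M)
  {r f : Ω → ℕ → Fin N → Fin M → ℝ}

theorem measurable_rhat (hr : ∀ s < t, ∀ i m, Measurable fun ω => r ω s i m)
    (p : Fin N × Fin M) : Measurable fun ω => rhat ⟨c, r ω, f ω⟩ A t p := by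
  -- The index set and its size depend on the completion times alone, so by definitional unfolding
  -- they are constant in `ω`.
  change Measurable fun ω => (∑ s ∈ completedJobs ⟨c, 0, 0⟩ A t p, r ω s p.1 p.2)
    / nJobs ⟨c, 0, 0⟩ A t p
  refine (Finset.measurable_sum _ fun s hs => hr s ?_ p.1 p.2).div_const _
  exact (Finset.mem_Ico.1 (completedJobs_subset _ _ _ _ hs)).2

theorem measurable_fhat (hf : ∀ s < t, ∀ i m, Measurable fun ω => f ω s i m)
    (p : Fin N × Fin M) : Measurable fun ω => fhat ⟨c, r ω, f ω⟩ A t p := by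
  change Measurable fun ω => (∑ s ∈ execRounds ⟨c, 0, 0⟩ A t p, f ω s p.1 p.2)
    / nExec ⟨c, 0, 0⟩ A t p
  refine (Finset.measurable_sum _ fun s hs => hf s ?_ p.1 p.2).div_const _
  exact (Finset.mem_Ico.1 (execRounds_subset _ _ _ _ hs)).2

theorem measurable_qhat (hr : ∀ s < t, ∀ i m, Measurable fun ω => r ω s i m) :
    Measurable fun ω => qhat ⟨c, r ω, f ω⟩ A t I := by
  refine measurable_pi_lambda _ fun i => measurable_pi_lambda _ fun m => ?_
  change Measurable fun ω => min 1 (rhat ⟨c, r ω, f ω⟩ A t (i, m) + radR ⟨c, 0, 0⟩ A t (i, m))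
    / max (I.Cl : ℝ) (chat ⟨c, 0, 0⟩ A t (i, m) - radC ⟨c, 0, 0⟩ A t I (i, m))
  exact (measurable_const.min ((measurable_rhat c A hr (i, m)).add_const _)).div_const _

theorem measurable_lcb (hf : ∀ s < t, ∀ i m, Measurable fun ω => f ω s i m)
    (a : Assignment N M) (m : Fin M) : Measurable fun ω => lcb ⟨c, r ω, f ω⟩ A t I a m := by
  change Measurable fun ω => ∑ i, fhat ⟨c, r ω, f ω⟩ A t (i, m) * entry a i m
    - radF ⟨c, 0, 0⟩ A t I a m
  exact (Finset.measurable_sum _ fun i _ => (measurable_fhat c A hf (i, m)).mul_const _).sub_const _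

theorem measurable_estFeasible (hf : ∀ s < t, ∀ i m, Measurable fun ω => f ω s i m) :
    Measurable fun ω => estFeasible ⟨c, r ω, f ω⟩ A t I := by
  unfold estFeasible
  refine measurable_finset_filter _ _ fun a => ?_
  rw [Set.ofPred_forall]
  exact MeasurableSet.iInter fun m => measurableSet_le (measurable_lcb I c A hf a m) measurable_const

theorem measurable_choosePlan {R} {B : ℕ} {α : ℝ} (hR : R.Valid B α)
    (hr : ∀ s < t, ∀ i m, Measurable fun ω => r ω s i m)
    (hf : ∀ s < t, ∀ i m, Measurable fun ω => f ω s i m) :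
    Measurable fun ω => choosePlan I R ⟨c, r ω, f ω⟩ A t := by
  unfold choosePlan
  refine measurable_of_countable_dependence
    (g := fun ω F => if F.Nonempty then R.oracle (qhat ⟨c, r ω, f ω⟩ A t I) F
      else R.fallback fun a => ∑ m, max (lcb ⟨c, r ω, f ω⟩ A t I a m) 0)
    (measurable_estFeasible I c A hf) fun F => ?_
  split_ifs with hF
  · exact measurable_to_countable' fun a =>
      measurable_qhat (f := f) I c A hr (hR.oracle_measurable F a)
  · have hg : Measurable fun ω => fun a : Assignment N M =>
        ∑ m, max (lcb ⟨c, r ω, f ω⟩ A t I a m) 0 :=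
      measurable_pi_lambda _ fun a => Finset.measurable_sum _ fun m _ =>
        (measurable_lcb I c A hf a m).max measurable_const
    exact measurable_to_countable' fun a => hg (hR.fallback_measurable a)

/-- With the state and the completion times fixed, all branching conditions outside `choosePlan` are
deterministic, and randomness enters only through the chosen plan. -/
theorem measurable_step {R} {B : ℕ} {α : ℝ} (hR : R.Valid B α)
    (hr : ∀ s < t, ∀ i m, Measurable fun ω => r ω s i m)
    (hf : ∀ s < t, ∀ i m, Measurable fun ω => f ω s i m) (σ : State N M) :
    (Measurable fun ω => (step I R T ⟨c, r ω, f ω⟩ t σ).past t) ∧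
      (Measurable fun ω => (step I R T ⟨c, r ω, f ω⟩ t σ).plan) ∧
      Measurable fun ω => (step I R T ⟨c, r ω, f ω⟩ t σ).nextPhase := by
  have hplan := measurable_choosePlan I c σ.past hR hr hf
  by_cases h : ∃ p, nJobs ⟨c, 0, 0⟩ σ.past t p < I.B T
  · have h' : ∀ ω, ∃ p, nJobs ⟨c, r ω, f ω⟩ σ.past t p < I.B T := fun _ => h
    simp only [step, if_pos (h' _), Function.update_self]
    exact ⟨measurable_const (a := R.init (started σ.past t) (running ⟨c, 0, 0⟩ σ.past t)),
      measurable_const, measurable_const⟩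
  · have h' : ∀ ω, ¬ ∃ p, nJobs ⟨c, r ω, f ω⟩ σ.past t p < I.B T := fun _ => h
    simp only [step, if_neg (h' _), Function.update_self]
    by_cases hn : σ.nextPhase ≤ t
    · simp only [if_pos hn]
      refine ⟨?_, hplan, measurable_const (a := t + phaseLength ⟨c, 0, 0⟩ σ.past t I)⟩
      exact (Measurable.of_discrete (f := fun a : Assignment N M =>
        if running ⟨c, 0, 0⟩ σ.past t ⊆ a then a \ running ⟨c, 0, 0⟩ σ.past t else ∅)).comp hplan
    · simp only [if_neg hn]
      exact ⟨measurable_const (a := if running ⟨c, 0, 0⟩ σ.past t ⊆ σ.plan then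
        σ.plan \ running ⟨c, 0, 0⟩ σ.past t else ∅), measurable_const, measurable_const⟩

end FixedHistory

variable {S : Ω → Samples N M} {t : ℕ}

/-- The actions of the algorithm up to round `t` are measurable functions of the samples of the
rounds before `t`. -/
theorem measurable_rounds {R} {B : ℕ} {α : ℝ} (hR : R.Valid B α)
    (hc : ∀ s < t, ∀ i m, Measurable fun ω => (S ω).c s i m)
    (hr : ∀ s < t, ∀ i m, Measurable fun ω => (S ω).r s i m)
    (hf : ∀ s < t, ∀ i m, Measurable fun ω => (S ω).f s i m) :
    ∀ u ≤ t, (∀ s ≤ u, Measurable fun ω => assign I R T (S ω) s) ∧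
      (Measurable fun ω => planAt I R T (S ω) u) ∧
      Measurable fun ω => nextAt I R T (S ω) u := by
  intro u
  induction u with
  | zero =>
    intro _
    refine ⟨fun s hs => ?_, measurable_const (a := ∅), measurable_const (a := 1)⟩
    obtain rfl : s = 0 := by omega
    exact measurable_const (a := ∅)
  | succ u ih =>
    intro hu
    obtain ⟨hA, hp, hn⟩ := ih (by omega)
    -- A countable type recording all that round `u + 1` reads of the past, apart from rewards and
    -- consumptions. `C` and `st` rebuild completion times and a state from it, with irrelevant
    -- values outside the recorded rounds.
    let δ := (Fin (u + 1) → Assignment N M × (Fin N → Fin M → ℕ)) × Assignment N M × ℕ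
    let d : Ω → δ := fun ω => (fun s => (assign I R T (S ω) s, (S ω).c s),
      planAt I R T (S ω) u, nextAt I R T (S ω) u)
    have hd : Measurable d := by
      refine Measurable.prodMk (measurable_pi_lambda _ fun s => ?_) (hp.prodMk hn)
      exact (hA s (by omega)).prodMk (measurable_pi_lambda _ fun i => measurable_pi_lambda _
        fun m => hc s (by omega) i m)
    let C : δ → ℕ → Fin N → Fin M → ℕ := fun x s => if h : s < u + 1 then (x.1 ⟨s, h⟩).2 else 0
    let st : δ → State N M := fun x =>
      ⟨fun s => if h : s < u + 1 then (x.1 ⟨s, h⟩).1 else ∅, x.2.1, x.2.2⟩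
    have key := fun ω => step_congr (S := S ω) (S' := ⟨C (d ω), (S ω).r, (S ω).f⟩)
      (t := u + 1) (σ := stateAfter I R T (S ω) u) (σ' := st (d ω)) I R T
      (by intro s hs; simp only [Finset.mem_Ico] at hs; simp [C, d, Nat.le_of_lt_succ hs.2])
      (fun _ _ => rfl) (fun _ _ => rfl)
      (by
        intro s hs
        have := stateAfter_past_Ico I R T (S ω) s hs
        simp only [Finset.mem_Ico] at hs; simp [st, d, Nat.le_of_lt_succ hs.2, this]) rfl rfl
    have hs := fun x => measurable_step (t := u + 1) (r := fun ω => (S ω).r)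
      (f := fun ω => (S ω).f) I T (C x) hR
      (fun s hs => hr s (by omega)) (fun s hs => hf s (by omega)) (st x)
    refine ⟨fun s hsu => ?_, ?_, ?_⟩
    · rcases Nat.lt_or_ge s (u + 1) with h | h
      · exact hA s (by omega)
      · obtain rfl : s = u + 1 := by omega
        exact measurable_of_forall_eq (measurable_of_countable_dependence hd fun x => (hs x).1)
          fun ω => (key ω).1
    · exact measurable_of_forall_eq (measurable_of_countable_dependence hd fun x => (hs x).2.1)
        fun ω => (key ω).2.1
    · exact measurable_of_forall_eq (measurable_of_countable_dependence hd fun x => (hs x).2.2)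
        fun ω => (key ω).2.2

/-- A function of the assignments up to round `t` and the completion times before round `t` that
takes values in a measurable space is measurable. -/
theorem measurable_of_history {γ : Type*} [MeasurableSpace γ] {R} {B : ℕ} {α : ℝ}
    (hR : R.Valid B α)
    (hc : ∀ s < t, ∀ i m, Measurable fun ω => (S ω).c s i m)
    (hr : ∀ s < t, ∀ i m, Measurable fun ω => (S ω).r s i m)
    (hf : ∀ s < t, ∀ i m, Measurable fun ω => (S ω).f s i m)
    (g : (ℕ → Assignment N M) → (ℕ → Fin N → Fin M → ℕ) → γ)
    (hg : ∀ A A' c c', (∀ s ≤ t, A s = A' s) → (∀ s < t, c s = c' s) → g A c = g A' c') :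
    Measurable fun ω => g (assign I R T (S ω)) (S ω).c := by
  have hA := (measurable_rounds I T hR hc hr hf t le_rfl).1
  let δ := (Fin (t + 1) → Assignment N M) × (Fin t → Fin N → Fin M → ℕ)
  let d : Ω → δ := fun ω => (fun s => assign I R T (S ω) s, fun s => (S ω).c s)
  have hd : Measurable d := by
    refine Measurable.prodMk (measurable_pi_lambda _ fun s => hA s (by omega)) ?_
    exact measurable_pi_lambda _ fun s => measurable_pi_lambda _ fun i => measurable_pi_lambda _
        fun m => hc s (by omega) i m
  refine measurable_of_forall_eq ((Measurable.of_discrete (f := fun x : δ =>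
    g (fun s => if h : s < t + 1 then x.1 ⟨s, h⟩ else ∅)
      (fun s => if h : s < t then x.2 ⟨s, h⟩ else 0))).comp hd) fun ω => ?_
  refine hg _ _ _ _ (fun s hs => ?_) fun s hs => ?_
  · simp [d, Nat.lt_succ_of_le hs]
  · simp [d, hs]

end Measurability

/-! ### Concentration for adaptively chosen observations -/

section Concentration

open scoped ENNReal

variable {Ω : Type*} {m0 : MeasurableSpace Ω} {P : Measure Ω} [IsProbabilityMeasure P]
  (ℱ : Filtration ℕ m0) {x : ℕ → Ω → ℝ} {E : ℕ → Ω → Prop} [∀ s ω, Decidable (E s ω)]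

/-- The exponential supermartingale of a predictably sampled sequence. -/
theorem lintegral_prod_sampled_le_one (hE : ∀ s, MeasurableSet[ℱ s] {ω | E s ω})
    (hx : ∀ s, Measurable[ℱ (s + 1)] (x s))
    (hind : ∀ s, Indep (ℱ s) (MeasurableSpace.comap (x s) inferInstance) P)
    {y : ℝ → ℝ≥0∞} (hy : Measurable y) (hyx : ∀ s, ∫⁻ ω, y (x s ω) ∂P ≤ 1) (t : ℕ) :
    ∫⁻ ω, ∏ s ∈ Finset.range t, (if E s ω then y (x s ω) else 1) ∂P ≤ 1 := by
  induction t with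
  | zero => simp
  | succ t ih =>
    set W : Ω → ℝ≥0∞ := fun ω => ∏ s ∈ Finset.range t, (if E s ω then y (x s ω) else 1) with hW
    have hWm : Measurable[ℱ t] W := by
      refine Finset.measurable_prod _ fun s hs => ?_
      have hst := Finset.mem_range.1 hs
      refine Measurable.ite (ℱ.mono hst.le _ (hE s)) ?_ measurable_const
      exact hy.comp ((hx s).mono (ℱ.mono hst) le_rfl)
    have hEm : MeasurableSet {ω | E t ω} := ℱ.le t _ (hE t)
    have hW1 : Measurable[ℱ t] ({ω | E t ω}.indicator W) := hWm.indicator (hE t)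
    have hW2 : Measurable ({ω | E t ω}ᶜ.indicator W) :=
      (hWm.mono (ℱ.le t) le_rfl).indicator hEm.compl
    -- On the event `E t` the new factor is independent of the past product and has mean at most
    -- `1`; off it the product is unchanged.
    have hprod : ∀ ω, (∏ s ∈ Finset.range (t + 1), (if E s ω then y (x s ω) else 1))
        = {ω | E t ω}.indicator W ω * y (x t ω) + {ω | E t ω}ᶜ.indicator W ω := by
      intro ω
      rw [Finset.prod_range_succ]
      by_cases h : E t ω <;> simp [Set.indicator, h, hW]
    have hxm : MeasurableSpace.comap (x t) inferInstance ≤ m0 :=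
      ((hx t).mono (ℱ.le _) le_rfl).comap_le
    calc ∫⁻ ω, ∏ s ∈ Finset.range (t + 1), (if E s ω then y (x s ω) else 1) ∂P
        = ∫⁻ ω, {ω | E t ω}.indicator W ω * y (x t ω) ∂P
            + ∫⁻ ω, {ω | E t ω}ᶜ.indicator W ω ∂P := by
          rw [← lintegral_add_right _ hW2]
          exact lintegral_congr hprod
      _ = (∫⁻ ω, {ω | E t ω}.indicator W ω ∂P) * (∫⁻ ω, y (x t ω) ∂P)
            + ∫⁻ ω, {ω | E t ω}ᶜ.indicator W ω ∂P := by
          have := lintegral_mul_eq_lintegral_mul_lintegral_of_independent_measurableSpace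
            (ℱ.le t) hxm (hind t) hW1 (hy.comp (comap_measurable (x t)))
          simp only [Function.comp_apply] at this
          rw [this]
      _ ≤ (∫⁻ ω, {ω | E t ω}.indicator W ω ∂P) + ∫⁻ ω, {ω | E t ω}ᶜ.indicator W ω ∂P := by
          gcongr
          exact mul_le_of_le_one_right' (hyx t)
      _ = ∫⁻ ω, W ω ∂P := by
          rw [lintegral_indicator hEm, lintegral_indicator hEm.compl, lintegral_add_compl _ hEm]
      _ ≤ 1 := ih

/-- A Hoeffding bound for predictably sampled sequences, uniform in the number of samples. -/
theorem measure_sampled_sum_gt_le (hE : ∀ s, MeasurableSet[ℱ s] {ω | E s ω})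
    (hx : ∀ s, Measurable[ℱ (s + 1)] (x s))
    (hind : ∀ s, Indep (ℱ s) (MeasurableSpace.comap (x s) inferInstance) P)
    (hmgf : ∀ s (l : ℝ), ∫⁻ ω, ENNReal.ofReal (Real.exp (l * x s ω)) ∂P
      ≤ ENNReal.ofReal (Real.exp (l ^ 2 / 8))) {t : ℕ} (ht : 1 ≤ t) :
    P {ω | Real.sqrt (1.5 * Real.log t * ((Finset.range t).filter (E · ω)).card)
        < ∑ s ∈ (Finset.range t).filter (E · ω), x s ω} ≤ ENNReal.ofReal (1 / (t : ℝ) ^ 2) := by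
  have htR : (1 : ℝ) ≤ t := by exact_mod_cast ht
  have hlog : 0 ≤ Real.log t := Real.log_nonneg htR
  -- The optimal Chernoff parameter for `n` observations: at the threshold the exponent is `6 ln t -
  -- 3 ln t = 3 ln t`. Each value of `n` thus has probability at most `t⁻³`, and the union over `n ≤
  -- t` costs a factor `t`.
  let l : ℕ → ℝ := fun n => 4 * Real.sqrt (1.5 * Real.log t / n)
  let y : ℕ → ℝ → ℝ≥0∞ := fun n z => ENNReal.ofReal (Real.exp (l n * z - l n ^ 2 / 8))
  let W : ℕ → Ω → ℝ≥0∞ := fun n ω =>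
    ∏ s ∈ Finset.range t, (if E s ω then y n (x s ω) else 1)
  have hym : ∀ n, Measurable (y n) := fun n => by fun_prop
  have hW : ∀ n, ∫⁻ ω, W n ω ∂P ≤ 1 := by
    intro n
    refine lintegral_prod_sampled_le_one ℱ hE hx hind (hym n) (fun s => ?_) t
    have : ∀ ω, y n (x s ω) = ENNReal.ofReal (Real.exp (l n * x s ω))
        * ENNReal.ofReal (Real.exp (-(l n ^ 2 / 8))) := by
      intro ω
      rw [← ENNReal.ofReal_mul (Real.exp_pos _).le, ← Real.exp_add, ← sub_eq_add_neg]
    rw [lintegral_congr this, lintegral_mul_const' _ _ ENNReal.ofReal_ne_top]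
    calc _ ≤ ENNReal.ofReal (Real.exp (l n ^ 2 / 8))
          * ENNReal.ofReal (Real.exp (-(l n ^ 2 / 8))) := by gcongr; exact hmgf s (l n)
      _ = 1 := by
        rw [← ENNReal.ofReal_mul (Real.exp_pos _).le, ← Real.exp_add]; simp
  have hWeq : ∀ n ω, W n ω = ENNReal.ofReal (Real.exp
      (l n * (∑ s ∈ (Finset.range t).filter (E · ω), x s ω)
        - ((Finset.range t).filter (E · ω)).card * (l n ^ 2 / 8))) := by
    intro n ω
    simp only [W]
    rw [← Finset.prod_filter, ← ENNReal.ofReal_prod_of_nonneg (fun _ _ => (Real.exp_pos _).le),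
      ← Real.exp_sum, Finset.sum_sub_distrib, Finset.mul_sum]
    simp
  have hWm : ∀ n, Measurable (W n) := by
    intro n
    refine Finset.measurable_prod _ fun s hs => ?_
    refine Measurable.ite (ℱ.le _ _ (hE s)) ?_ measurable_const
    exact (hym n).comp ((hx s).mono (ℱ.le _) le_rfl)
  have hsub : {ω | Real.sqrt (1.5 * Real.log t * ((Finset.range t).filter (E · ω)).card)
        < ∑ s ∈ (Finset.range t).filter (E · ω), x s ω}
      ⊆ ⋃ n ∈ Finset.Icc 1 t, {ω | ENNReal.ofReal ((t : ℝ) ^ 3) ≤ W n ω} := by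
    intro ω hω
    simp only [Set.mem_ofPred_eq] at hω
    set F := (Finset.range t).filter (E · ω) with hF
    -- Without observations the strict inequality defining the event would read `0 < 0`.
    have hn1 : 1 ≤ F.card := by
      rw [Nat.one_le_iff_ne_zero, Ne, Finset.card_eq_zero]
      intro h
      simp [h] at hω
    have hnt : F.card ≤ t := by simpa using Finset.card_filter_le (Finset.range t) (E · ω)
    refine Set.mem_biUnion (Finset.mem_coe.2 (Finset.mem_Icc.2 ⟨hn1, hnt⟩)) ?_
    simp only [Set.mem_ofPred_eq, hWeq]
    refine ENNReal.ofReal_le_ofReal ?_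
    have hnR : (0 : ℝ) < F.card := by exact_mod_cast hn1
    have h3 : (t : ℝ) ^ 3 = Real.exp (3 * Real.log t) := by
      rw [mul_comm, Real.exp_mul, Real.exp_log (by linarith)]
      norm_cast
    rw [h3]
    refine Real.exp_le_exp.2 ?_
    have hl0 : 0 ≤ l F.card := by positivity
    have hsq : l F.card ^ 2 = 16 * (1.5 * Real.log t / F.card) := by
      simp only [l]
      rw [mul_pow, Real.sq_sqrt (by positivity)]
      norm_num
    have hpr : l F.card * Real.sqrt (1.5 * Real.log t * F.card) = 4 * (1.5 * Real.log t) := by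
      simp only [l]
      rw [mul_assoc, ← Real.sqrt_mul (by positivity)]
      congr 1
      rw [show 1.5 * Real.log t / (F.card : ℝ) * (1.5 * Real.log t * F.card)
        = (1.5 * Real.log t) ^ 2 by field_simp, Real.sqrt_sq (by positivity)]
    have hmul := mul_le_mul_of_nonneg_left hω.le hl0
    rw [hpr] at hmul
    have : (F.card : ℝ) * (l F.card ^ 2 / 8) = 3 * Real.log t := by
      rw [hsq]; field_simp; norm_num; ring
    rw [← hF]
    linarith
  have ht0 : ENNReal.ofReal ((t : ℝ) ^ 3) ≠ 0 := by
    rw [Ne, ENNReal.ofReal_eq_zero, not_le]; positivity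
  have hmarkov : ∀ n, P {ω | ENNReal.ofReal ((t : ℝ) ^ 3) ≤ W n ω}
      ≤ ENNReal.ofReal (1 / (t : ℝ) ^ 3) := by
    intro n
    have h := meas_ge_le_lintegral_div (hWm n).aemeasurable ht0 ENNReal.ofReal_ne_top (μ := P)
    refine h.trans ?_
    rw [ENNReal.ofReal_div_of_pos (by positivity), ENNReal.ofReal_one]
    gcongr
    exact hW n
  calc _ ≤ P (⋃ n ∈ Finset.Icc 1 t, {ω | ENNReal.ofReal ((t : ℝ) ^ 3) ≤ W n ω}) :=
        measure_mono hsub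
    _ ≤ ∑ n ∈ Finset.Icc 1 t, P {ω | ENNReal.ofReal ((t : ℝ) ^ 3) ≤ W n ω} :=
        measure_biUnion_finset_le _ _
    _ ≤ ∑ n ∈ Finset.Icc 1 t, ENNReal.ofReal (1 / (t : ℝ) ^ 3) :=
        Finset.sum_le_sum fun n _ => hmarkov n
    _ = ENNReal.ofReal (1 / (t : ℝ) ^ 2) := by
        rw [Finset.sum_const, Nat.card_Icc, nsmul_eq_mul, ← ENNReal.ofReal_natCast,
          ← ENNReal.ofReal_mul (by positivity)]
        congr 1
        push_cast [Nat.add_sub_cancel]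
        field_simp

/-- Hoeffding's lemma: a variable in `[0, 1]` has sub-Gaussian parameter `1 / 4`. The lower
deviation is obtained by replacing `l` with `-l`. -/
theorem lintegral_exp_mean_sub_le {X : Ω → ℝ} (hX : Measurable X)
    (hb : ∀ᵐ ω ∂P, X ω ∈ Set.Icc (0 : ℝ) 1) (l : ℝ) :
    ∫⁻ ω, ENNReal.ofReal (Real.exp (l * (P[X] - X ω))) ∂P
      ≤ ENNReal.ofReal (Real.exp (l ^ 2 / 8)) := by
  have h := hasSubgaussianMGF_of_mem_Icc hX.aemeasurable hb
  have he : ∀ ω, l * (P[X] - X ω) = -l * (X ω - P[X]) := fun ω => by ring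
  simp only [he]
  rw [← ofReal_integral_eq_lintegral_ofReal (h.integrable_exp_mul (-l))
    (Filter.Eventually.of_forall fun _ => (Real.exp_pos _).le)]
  refine ENNReal.ofReal_le_ofReal ((h.mgf_le (-l)).trans (Real.exp_le_exp.2 ?_))
  have : (((‖(1 : ℝ) - 0‖₊ / 2) ^ 2 : NNReal) : ℝ) = 1 / 4 := by
    push_cast; norm_num
  rw [this]
  linarith

end Concentration

/-! ### The sample filtration and the probability of underestimation -/

section Sampling

variable {N M : ℕ} {I : Instance N M} {Ω : Type*} {m0 : MeasurableSpace Ω} {P : Measure Ω}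
  {S : Ω → Samples N M}

theorem IsSampling.measurable_coord (hS : IsSampling I P S) (k : Fin 3 × ℕ × Fin N × Fin M) :
    Measurable fun ω => (S ω).coord k := by
  obtain ⟨j, t, i, m⟩ := k
  fin_cases j
  · exact (Measurable.of_discrete (f := fun n : ℕ => (n : ℝ))).comp (hS.measurable_c t i m)
  · exact hS.measurable_r t i m
  · exact hS.measurable_f t i m

/-- The information contained in the samples of the rounds before `t`. -/
def sampleFiltration (hS : IsSampling I P S) : Filtration ℕ m0 where
  seq t := ⨆ k ∈ {k : Fin 3 × ℕ × Fin N × Fin M | k.2.1 < t},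
    MeasurableSpace.comap (fun ω => (S ω).coord k) inferInstance
  mono' _ _ hst := biSup_mono fun _ hk => lt_of_lt_of_le hk hst
  le' _ := iSup₂_le fun k _ => (hS.measurable_coord k).comap_le

theorem sampleFiltration_measurable_coord (hS : IsSampling I P S) {t : ℕ}
    {k : Fin 3 × ℕ × Fin N × Fin M} (hk : k.2.1 < t) :
    Measurable[sampleFiltration hS t] fun ω => (S ω).coord k :=
  Measurable.of_comap_le (le_iSup₂ (f := fun (k : Fin 3 × ℕ × Fin N × Fin M)
    (_ : k ∈ {k : Fin 3 × ℕ × Fin N × Fin M | k.2.1 < t}) =>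
    MeasurableSpace.comap (fun ω => (S ω).coord k) inferInstance) k hk)

theorem sampleFiltration_measurable_c (hS : IsSampling I P S) {s t : ℕ} (hst : s < t)
    (i : Fin N) (m : Fin M) : Measurable[sampleFiltration hS t] fun ω => (S ω).c s i m := by
  -- The coordinates are real; taking the floor recovers the integer completion time.
  have h := Nat.measurable_floor.comp
    (sampleFiltration_measurable_coord hS (t := t) (k := (0, s, i, m)) hst)
  have he : (fun ω => (S ω).c s i m) = fun ω => ⌊(S ω).coord (0, s, i, m)⌋₊ :=
    funext fun ω => (Nat.floor_natCast _).symm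
  rw [he]
  exact h

theorem sampleFiltration_measurable_r (hS : IsSampling I P S) {s t : ℕ} (hst : s < t)
    (i : Fin N) (m : Fin M) : Measurable[sampleFiltration hS t] fun ω => (S ω).r s i m :=
  sampleFiltration_measurable_coord hS (k := (1, s, i, m)) hst

theorem sampleFiltration_measurable_f (hS : IsSampling I P S) {s t : ℕ} (hst : s < t)
    (i : Fin N) (m : Fin M) : Measurable[sampleFiltration hS t] fun ω => (S ω).f s i m :=
  sampleFiltration_measurable_coord hS (k := (2, s, i, m)) hst

theorem indep_sampleFiltration_f (hS : IsSampling I P S) (t : ℕ) (i : Fin N) (m : Fin M) :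
    Indep (sampleFiltration hS t)
      (MeasurableSpace.comap (fun ω => (S ω).f t i m) inferInstance) P := by
  have h := indep_iSup_of_disjoint (fun k => (hS.measurable_coord k).comap_le) hS.indep
    (S := {k : Fin 3 × ℕ × Fin N × Fin M | k.2.1 < t}) (T := {(2, t, i, m)}) (by simp)
  rw [iSup_singleton] at h
  exact h

theorem IsSampling.ae_c_mem (hS : IsSampling I P S) :
    ∀ᵐ ω ∂P, ∀ t i m, I.Cl ≤ (S ω).c t i m ∧ (S ω).c t i m ≤ I.Cu := by
  refine ae_all_iff.2 fun t => ae_all_iff.2 fun i => ae_all_iff.2 fun m => ?_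
  have h := I.lawC_supp i m
  rw [← hS.law_c t i m, Measure.map_apply (hS.measurable_c t i m) (MeasurableSet.of_discrete)] at h
  exact h

theorem IsSampling.ae_f_mem (hS : IsSampling I P S) (t : ℕ) (i : Fin N) (m : Fin M) :
    ∀ᵐ ω ∂P, (S ω).f t i m ∈ Set.Icc (0 : ℝ) 1 := by
  have h := I.lawF_supp i m
  rw [← hS.law_f t i m, Measure.map_apply (hS.measurable_f t i m) measurableSet_Icc.compl] at h
  exact h

theorem IsSampling.integral_f (hS : IsSampling I P S) (t : ℕ) (i : Fin N) (m : Fin M) :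
    ∫ ω, (S ω).f t i m ∂P = I.fbar i m := by
  unfold Instance.fbar
  rw [← hS.law_f t i m]
  exact (integral_map (hS.measurable_f t i m).aemeasurable aestronglyMeasurable_id).symm

variable (I) (R : Routines N M) (T : ℕ)

/-- Before round `t`, the observed consumption of the pair `p` falls short of its mean by more
than the confidence radius. -/
def Underestimated (S : Samples N M) (t : ℕ) (p : Fin N × Fin M) : Prop :=
  Real.sqrt (1.5 * Real.log t * nExec S (assign I R T S) t p)
    < ∑ s ∈ execRounds S (assign I R T S) t p, (I.fbar p.1 p.2 - S.f s p.1 p.2)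

variable {I R}

/-- Predictability: the decision to execute a pair in round `s` uses only samples of rounds before
`s`, so it belongs to the σ-algebra that is independent of the consumption in round `s`. -/
theorem measurableSet_executing {α : ℝ} {B : ℕ} (hS : IsSampling I P S) (hR : R.Valid B α)
    (p : Fin N × Fin M) (s : ℕ) :
    MeasurableSet[sampleFiltration hS s] {ω | 1 ≤ s ∧
      p ∈ assign I R T (S ω) s ∪ running (S ω) (assign I R T (S ω)) s} := by
  have := @measurable_of_history N M Ω (sampleFiltration hS s) I T S s Prop _ R B α hR
    (fun u hu i m => sampleFiltration_measurable_c hS hu i m)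
    (fun u hu i m => sampleFiltration_measurable_r hS hu i m)
    (fun u hu i m => sampleFiltration_measurable_f hS hu i m)
    (fun A c => 1 ≤ s ∧ p ∈ A s ∪ running ⟨c, 0, 0⟩ A s) (by
      intro A A' c c' hA hc
      rw [hA s le_rfl, running_congr (S := ⟨c, 0, 0⟩) (S' := ⟨c', 0, 0⟩) (A' := A')]
      · intro u hu
        exact hc u (Finset.mem_Ico.1 hu).2
      · intro u hu
        exact hA u (Finset.mem_Ico.1 hu).2.le)
  exact (@measurableSet_setOfPred _ (sampleFiltration hS s) _).2 this

theorem execRounds_eq_filter (S : Samples N M) (A : ℕ → Assignment N M) (t : ℕ)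
    (p : Fin N × Fin M) : execRounds S A t p
      = (Finset.range t).filter fun s => 1 ≤ s ∧ p ∈ A s ∪ running S A s := by
  ext s
  simp only [execRounds, Finset.mem_filter, Finset.mem_Ico, Finset.mem_range]
  tauto

theorem measure_underestimated_le [IsProbabilityMeasure P] {α : ℝ} {B : ℕ}
    (hS : IsSampling I P S) (hR : R.Valid B α) (p : Fin N × Fin M) {t : ℕ} (ht : 1 ≤ t) :
    P {ω | Underestimated I R T (S ω) t p} ≤ ENNReal.ofReal (1 / (t : ℝ) ^ 2) := by
  have h := measure_sampled_sum_gt_le (P := P) (sampleFiltration hS)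
    (x := fun s ω => I.fbar p.1 p.2 - (S ω).f s p.1 p.2)
    (E := fun s ω => 1 ≤ s ∧ p ∈ assign I R T (S ω) s ∪ running (S ω) (assign I R T (S ω)) s)
    (measurableSet_executing T hS hR p)
    (fun s => (sampleFiltration_measurable_f hS (Nat.lt_succ_self s) p.1 p.2).const_sub _)
    (fun s => ?_) (fun s l => ?_) ht
  · simpa only [Underestimated, nExec, execRounds_eq_filter] using h
  · refine indep_of_indep_of_le_right (indep_sampleFiltration_f hS s p.1 p.2) ?_
    exact (Measurable.const_sub (comap_measurable _) _).comap_le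
  · rw [← hS.integral_f s p.1 p.2]
    exact lintegral_exp_mean_sub_le (hS.measurable_f s p.1 p.2) (hS.ae_f_mem s p.1 p.2) l

theorem measurableSet_underestimated {α : ℝ} {B : ℕ}
    (hS : IsSampling I P S) (hR : R.Valid B α) (p : Fin N × Fin M) (t : ℕ) :
    MeasurableSet {ω | Underestimated I R T (S ω) t p} := by
  have hE : ∀ s, MeasurableSet {ω | 1 ≤ s ∧
      p ∈ assign I R T (S ω) s ∪ running (S ω) (assign I R T (S ω)) s} := fun s =>
    (sampleFiltration hS).le s _ (measurableSet_executing T hS hR p s)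
  simp only [Underestimated, nExec, execRounds_eq_filter, Finset.sum_filter, Finset.card_filter]
  push_cast
  refine measurableSet_lt ?_ ?_
  · refine Measurable.sqrt (Measurable.const_mul (Finset.measurable_sum _ fun s _ => ?_) _)
    exact Measurable.ite (hE s) measurable_const measurable_const
  · refine Finset.measurable_sum _ fun s _ => ?_
    exact Measurable.ite (hE s) ((hS.measurable_f s p.1 p.2).const_sub _) measurable_const

theorem measurable_totalExcess {α : ℝ} {B : ℕ} (hS : IsSampling I P S) (hR : R.Valid B α) :
    Measurable fun ω => totalExcess I R T (S ω) := by
  refine measurable_of_history (t := T + 1) I T hR (fun s _ => hS.measurable_c s)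
    (fun s _ => hS.measurable_r s) (fun s _ => hS.measurable_f s)
    (fun A c => ∑ t ∈ Finset.Icc 1 T, ∑ m, max 0
    (∑ i, I.fbar i m * (entry (A t) i m + entry (running ⟨c, 0, 0⟩ A t) i m) - I.L m)) ?_
  intro A A' c c' hA hc
  refine Finset.sum_congr rfl fun t ht => ?_
  have htT := (Finset.mem_Icc.1 ht).2
  rw [hA t (by omega), running_congr (S := ⟨c, 0, 0⟩) (S' := ⟨c', 0, 0⟩) (A' := A')]
  · intro u hu
    exact hc u (by have := (Finset.mem_Ico.1 hu).2; omega)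
  · intro u hu
    exact hA u (by have := (Finset.mem_Ico.1 hu).2; omega)

end Sampling

/-! ### Combinatorics of running and completed jobs -/

section Schedule

variable {N M : ℕ} {S : Samples N M} {A : ℕ → Assignment N M} {t : ℕ} {p : Fin N × Fin M}

theorem mem_running : p ∈ running S A t ↔
    ∃ s, 1 ≤ s ∧ s < t ∧ p ∈ A s ∧ t < s + S.c s p.1 p.2 := by
  unfold running
  rw [Finset.mem_filter]
  simp only [Finset.mem_filter, Finset.mem_univ, true_and, Finset.Nonempty, Finset.mem_Ico,
    and_assoc]

theorem mem_completedJobs {s : ℕ} : s ∈ completedJobs S A t p ↔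
    1 ≤ s ∧ s < t ∧ p ∈ A s ∧ s + S.c s p.1 p.2 ≤ t := by
  simp only [completedJobs, Finset.mem_filter, Finset.mem_Ico, and_assoc]

theorem mem_execRounds {s : ℕ} : s ∈ execRounds S A t p ↔
    1 ≤ s ∧ s < t ∧ p ∈ A s ∪ running S A s := by
  simp only [execRounds, Finset.mem_filter, Finset.mem_Ico, and_assoc]

theorem running_one (S : Samples N M) (A : ℕ → Assignment N M) : running S A 1 = ∅ := by
  ext p
  simp only [mem_running, Finset.notMem_empty, iff_false]
  rintro ⟨s, h1, h2, -⟩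
  omega

theorem running_succ_subset (S : Samples N M) (A : ℕ → Assignment N M) (t : ℕ) :
    running S A (t + 1) ⊆ A t ∪ running S A t := by
  intro p hp
  obtain ⟨s, h1, h2, h3, h4⟩ := mem_running.1 hp
  rcases Nat.lt_succ_iff_lt_or_eq.1 h2 with h | rfl
  · exact Finset.mem_union_right _ (mem_running.2 ⟨s, h1, h, h3, by omega⟩)
  · exact Finset.mem_union_left _ h3

theorem started_one (A : ℕ → Assignment N M) (p : Fin N × Fin M) : started A 1 p = 0 := by
  simp [started]

theorem started_succ (ht : 1 ≤ t) :
    started A (t + 1) p = started A t p + if p ∈ A t then 1 else 0 := by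
  unfold started
  rw [← Finset.insert_Ico_right_eq_Ico_add_one ht, Finset.filter_insert]
  split_ifs with h
  · rw [Finset.card_insert_of_notMem (by simp)]
  · rfl

theorem completedJobs_mono {u : ℕ} (htu : t ≤ u) :
    completedJobs S A t p ⊆ completedJobs S A u p := by
  intro s hs
  rw [mem_completedJobs] at hs ⊢
  exact ⟨hs.1, by omega, hs.2.2.1, by omega⟩

theorem nJobs_mono {u : ℕ} (htu : t ≤ u) : nJobs S A t p ≤ nJobs S A u p :=
  Finset.card_le_card (completedJobs_mono htu)

theorem nJobs_lt_started (hp : p ∈ running S A t) : nJobs S A t p < started A t p := by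
  obtain ⟨s, h1, h2, h3, h4⟩ := mem_running.1 hp
  refine Finset.card_lt_card (Finset.ssubset_iff_of_subset ?_ |>.2 ⟨s, ?_, ?_⟩)
  · intro u hu
    rw [mem_completedJobs] at hu
    simp [hu.1, hu.2.1, hu.2.2.1]
  · simp [h1, h2, h3]
  · rw [mem_completedJobs]
    omega

theorem nJobs_eq_started (hp : p ∉ running S A t) : nJobs S A t p = started A t p := by
  unfold nJobs started completedJobs
  congr 1
  refine Finset.filter_congr fun s hs => ⟨fun h => h.1, fun h => ⟨h, ?_⟩⟩
  by_contra hlt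
  obtain ⟨h1, h2⟩ := Finset.mem_Ico.1 hs
  exact hp (mem_running.2 ⟨s, h1, h2, h, by omega⟩)

theorem nJobs_le_nExec : nJobs S A t p ≤ nExec S A t p := by
  refine Finset.card_le_card fun s hs => ?_
  rw [mem_completedJobs] at hs
  exact mem_execRounds.2 ⟨hs.1, hs.2.1, Finset.mem_union_left _ hs.2.2.1⟩

theorem nExec_le : nExec S A t p ≤ t :=
  (Finset.card_le_card (execRounds_subset S A t p)).trans (by simp)

/-- If no job is started while a job of the same pair is running, then each completed job
occupies its own rounds of execution. -/
theorem mul_nJobs_le_nExec {Cl : ℕ} (hc : ∀ t i m, Cl ≤ S.c t i m)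
    (hdisj : ∀ s, 1 ≤ s → Disjoint (A s) (running S A s)) :
    Cl * nJobs S A t p ≤ nExec S A t p := by
  have hpair : ((completedJobs S A t p : Finset ℕ) : Set ℕ).PairwiseDisjoint
      fun s => Finset.Ico s (s + S.c s p.1 p.2) := by
    have key : ∀ s ∈ completedJobs S A t p, ∀ u ∈ completedJobs S A t p, s < u →
        s + S.c s p.1 p.2 ≤ u := by
      intro s hs u hu hsu
      rw [mem_completedJobs] at hs hu
      by_contra hlt
      exact Finset.disjoint_left.1 (hdisj u hu.1) hu.2.2.1
        (mem_running.2 ⟨s, hs.1, hsu, hs.2.2.1, by omega⟩)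
    intro s hs u hu hsu
    simp only [Function.onFun]
    rw [Finset.disjoint_left]
    intro x hx hx'
    rw [Finset.mem_Ico] at hx hx'
    rcases lt_or_gt_of_ne hsu with h | h
    · have := key s hs u hu h
      omega
    · have := key u hu s hs h
      omega
  have hsub : (completedJobs S A t p).biUnion (fun s => Finset.Ico s (s + S.c s p.1 p.2))
      ⊆ execRounds S A t p := by
    intro x hx
    obtain ⟨s, hs, hx⟩ := Finset.mem_biUnion.1 hx
    rw [mem_completedJobs] at hs
    rw [Finset.mem_Ico] at hx
    refine mem_execRounds.2 ⟨by omega, by omega, ?_⟩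
    rcases hx.1.lt_or_eq with h | rfl
    · exact Finset.mem_union_right _ (mem_running.2 ⟨s, hs.1, h, hs.2.2.1, hx.2⟩)
    · exact Finset.mem_union_left _ hs.2.2.1
  calc Cl * nJobs S A t p = ∑ _s ∈ completedJobs S A t p, Cl := by
        rw [Finset.sum_const, smul_eq_mul, mul_comm]; rfl
    _ ≤ ∑ s ∈ completedJobs S A t p, (Finset.Ico s (s + S.c s p.1 p.2)).card :=
        Finset.sum_le_sum fun s _ => by simpa using hc s p.1 p.2
    _ = _ := (Finset.card_biUnion hpair).symm
    _ ≤ _ := Finset.card_le_card hsub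

end Schedule

/-! ### Gaps and excess of assignments -/

section Gaps

variable {N M : ℕ} (I : Instance N M) {a a' b : Assignment N M}

theorem empty_mem_possible : (∅ : Assignment N M) ∈ possible N M := by
  simp [possible]

theorem possible_of_subset (h : a' ∈ possible N M) (hs : a ⊆ a') : a ∈ possible N M := by
  simp only [possible, Finset.mem_filter, Finset.mem_univ, true_and] at h ⊢
  exact fun i => (Finset.card_le_card fun m hm => by
    simp only [Finset.mem_filter, Finset.mem_univ, true_and] at hm ⊢
    exact hs hm).trans (h i)

theorem entry_nonneg (a : Assignment N M) (i : Fin N) (m : Fin M) : 0 ≤ entry a i m := by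
  unfold entry; split_ifs <;> norm_num

theorem entry_le_one (a : Assignment N M) (i : Fin N) (m : Fin M) : entry a i m ≤ 1 := by
  unfold entry; split_ifs <;> norm_num

theorem entry_add_le (hd : Disjoint a b) (hs : a ∪ b ⊆ a') (i : Fin N) (m : Fin M) :
    entry a i m + entry b i m ≤ entry a' i m := by
  have h : (i, m) ∈ a → (i, m) ∉ b := fun h => Finset.disjoint_left.1 hd h
  have h' : (i, m) ∈ a ∪ b → (i, m) ∈ a' := fun h => hs h
  unfold entry
  by_cases h1 : (i, m) ∈ a <;> by_cases h2 : (i, m) ∈ b <;> by_cases h3 : (i, m) ∈ a' <;>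
    simp_all

theorem Instance.fbar_nonneg (i : Fin N) (m : Fin M) : 0 ≤ I.fbar i m := by
  refine integral_nonneg_of_ae ?_
  have h : ∀ᵐ x ∂(I.lawF i m), x ∈ Set.Icc (0 : ℝ) 1 := I.lawF_supp i m
  exact h.mono fun x hx => hx.1

theorem Instance.fbar_le_one (i : Fin N) (m : Fin M) : I.fbar i m ≤ 1 := by
  have := I.lawF_prob i m
  have h : ∀ᵐ x ∂(I.lawF i m), x ∈ Set.Icc (0 : ℝ) 1 := I.lawF_supp i m
  calc I.fbar i m ≤ ∫ _x, (1 : ℝ) ∂(I.lawF i m) :=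
        integral_mono_ae (Integrable.of_mem_Icc 0 1 aemeasurable_id h) (integrable_const _)
          (h.mono fun x hx => hx.2)
    _ = 1 := by simp

theorem Instance.gapAgent_nonneg (a : Assignment N M) (m : Fin M) : 0 ≤ I.gapAgent a m :=
  le_max_right _ _

theorem Instance.gap_nonneg (a : Assignment N M) : 0 ≤ I.gap a :=
  Finset.sum_nonneg fun m _ => I.gapAgent_nonneg a m

theorem Instance.gap_eq_zero (h : a ∈ I.feasible) : I.gap a = 0 := by
  refine Finset.sum_eq_zero fun m _ => max_eq_right ?_
  have := (Finset.mem_filter.1 h).2 m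
  linarith

theorem Instance.gap_empty : I.gap ∅ = 0 := by
  refine I.gap_eq_zero (Finset.mem_filter.2 ⟨empty_mem_possible, fun m => ?_⟩)
  simpa [entry] using I.L_nonneg m

/-- Each task is counted for at most one agent and consumes at most `1` on average, and capacities
are nonnegative. -/
theorem Instance.gap_le (h : a ∈ possible N M) : I.gap a ≤ N := by
  calc I.gap a ≤ ∑ m, ∑ i, entry a i m := by
        refine Finset.sum_le_sum fun m _ => max_le ?_ (Finset.sum_nonneg fun i _ =>
          entry_nonneg a i m)
        have : ∑ i, I.fbar i m * entry a i m ≤ ∑ i, entry a i m :=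
          Finset.sum_le_sum fun i _ =>
            mul_le_of_le_one_left (entry_nonneg a i m) (I.fbar_le_one i m)
        linarith [I.L_nonneg m]
    _ = ∑ i, ∑ m, entry a i m := Finset.sum_comm
    _ ≤ ∑ _i : Fin N, (1 : ℝ) := by
        refine Finset.sum_le_sum fun i _ => ?_
        have := (Finset.mem_filter.1 h).2 i
        simp only [entry, Finset.sum_boole]
        exact_mod_cast this
    _ = N := by simp

/-- The excess over the capacities when the jobs in `a` are started and those in `b` running. -/
def Instance.excess (a b : Assignment N M) : ℝ :=
  ∑ m, max 0 (∑ i, I.fbar i m * (entry a i m + entry b i m) - I.L m)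

theorem Instance.excess_nonneg (a b : Assignment N M) : 0 ≤ I.excess a b :=
  Finset.sum_nonneg fun _ _ => le_max_left _ _

theorem Instance.excess_le_gap (hd : Disjoint a b) (hs : a ∪ b ⊆ a') :
    I.excess a b ≤ I.gap a' := by
  refine Finset.sum_le_sum fun m _ => ?_
  unfold Instance.gapAgent
  rw [max_comm]
  refine max_le_max (sub_le_sub_right (Finset.sum_le_sum fun i _ => ?_) _) le_rfl
  exact mul_le_mul_of_nonneg_left (entry_add_le hd hs i m) (I.fbar_nonneg i m)

/-- A crude bound for arbitrary assignments, which holds on every realisation and so gives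
integrability. -/
theorem Instance.excess_le (a b : Assignment N M) : I.excess a b ≤ M * (N * 2) := by
  calc I.excess a b ≤ ∑ _m : Fin M, ∑ _i : Fin N, (2 : ℝ) := by
        refine Finset.sum_le_sum fun m _ => max_le (by positivity) ?_
        have : ∑ i, I.fbar i m * (entry a i m + entry b i m) ≤ ∑ _i : Fin N, (2 : ℝ) := by
          refine Finset.sum_le_sum fun i _ => ?_
          have h0 := I.fbar_nonneg i m
          have h1 := I.fbar_le_one i m
          have h2 := entry_nonneg a i m
          have h3 := entry_le_one a i m
          have h4 := entry_nonneg b i m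
          have h5 := entry_le_one b i m
          nlinarith
        linarith [I.L_nonneg m]
    _ = _ := by simp

end Gaps

/-! ### Initialization, phases and transitions -/

section Phases

variable {N M : ℕ} {I : Instance N M} {R : Routines N M} {T : ℕ} {S : Samples N M}

theorem isInit_of_le {t u : ℕ} (htu : t ≤ u) (h : IsInit I R T S u) : IsInit I R T S t := by
  obtain ⟨p, hp⟩ := h
  exact ⟨p, (nJobs_mono htu).trans_lt hp⟩

/-- The jobs that are executed in round `t`. -/
def occupied (I : Instance N M) (R : Routines N M) (T : ℕ) (S : Samples N M) (t : ℕ) :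
    Assignment N M :=
  assign I R T S t ∪ running S (assign I R T S) t

theorem running_succ_subset_occupied (t : ℕ) :
    running S (assign I R T S) (t + 1) ⊆ occupied I R T S t := running_succ_subset _ _ _

section Init

variable {α : ℝ}

theorem running_possible_of_isInit (hR : R.Valid (I.B T) α) {t : ℕ} (ht : 1 ≤ t)
    (h : IsInit I R T S t) : running S (assign I R T S) t ∈ possible N M := by
  induction t, ht using Nat.le_induction with
  | base => rw [running_one]; exact empty_mem_possible
  | succ t ht ih =>
    have h' := isInit_of_le (Nat.le_succ t) h
    refine possible_of_subset ?_ (running_succ_subset _ _ _)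
    rw [(round_init I R T S ht h').1]
    exact (hR.init_possible _ _ (ih h')).2

theorem occupied_possible_of_isInit (hR : R.Valid (I.B T) α) {t : ℕ} (ht : 1 ≤ t)
    (h : IsInit I R T S t) : occupied I R T S t ∈ possible N M := by
  rw [occupied, (round_init I R T S ht h).1]
  exact (hR.init_possible _ _ (running_possible_of_isInit hR ht h)).2

theorem assign_disjoint_running (hR : R.Valid (I.B T) α) {t : ℕ} (ht : 1 ≤ t) :
    Disjoint (assign I R T S t) (running S (assign I R T S) t) := by
  by_cases h : IsInit I R T S t
  · rw [(round_init I R T S ht h).1]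
    exact (hR.init_possible _ _ (running_possible_of_isInit hR ht h)).1
  · rw [round_run I R T S ht h]
    split_ifs
    · exact Finset.sdiff_disjoint
    · exact Finset.disjoint_empty_left _

theorem started_le_of_isInit (hR : R.Valid (I.B T) α) {t : ℕ} (ht : 1 ≤ t)
    (h : ∀ s, 1 ≤ s → s < t → IsInit I R T S s) (p : Fin N × Fin M) :
    started (assign I R T S) t p ≤ I.B T := by
  induction t, ht using Nat.le_induction with
  | base => simp [started_one]
  | succ t ht ih =>
    have ih' := ih fun s h1 hs => h s h1 (by omega)
    have hI := h t ht (by omega)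
    rw [started_succ ht]
    split_ifs with hp
    · rw [(round_init I R T S ht hI).1] at hp
      exact hR.init_le _ _ (running_possible_of_isInit hR ht hI) p hp
    · exact ih'

/-- A running job would be started but not completed; yet at most `B` jobs of each pair were
started, and all pairs have completed at least `B`. Hence the first phase has no transition. -/
theorem running_eq_empty_of_isInit_pred (hR : R.Valid (I.B T) α) {t : ℕ} (ht : 1 ≤ t)
    (h : ¬ IsInit I R T S t) (hpred : t = 1 ∨ IsInit I R T S (t - 1)) :
    running S (assign I R T S) t = ∅ := by
  rcases hpred with rfl | hpred
  · exact running_one _ _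
  · refine Finset.eq_empty_of_forall_notMem fun p hp => ?_
    have h1 := nJobs_lt_started hp
    have h2 := started_le_of_isInit hR ht
      (fun s _ hs => isInit_of_le (by omega : s ≤ t - 1) hpred) p
    exact h ⟨p, h1.trans_le h2⟩

theorem occupied_nonempty_of_isInit (hR : R.Valid (I.B T) α) {t : ℕ} (ht : 1 ≤ t)
    (h : IsInit I R T S t) : (occupied I R T S t).Nonempty := by
  by_cases hb : running S (assign I R T S) t = ∅
  · obtain ⟨p, hp⟩ := h
    have hn : (R.init (started (assign I R T S) t) ∅).Nonempty := by
      refine hR.init_nonidle _ ⟨p, ?_⟩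
      rwa [← nJobs_eq_started (S := S) (by simp [hb])]
    rw [occupied, (round_init I R T S ht ⟨p, hp⟩).1, hb]
    simpa using hn
  · exact (Finset.nonempty_iff_ne_empty.2 hb).mono Finset.subset_union_right

open Classical in
-- Every initialization round lies in an interval of `C_u` rounds following the start of a job, and
-- at most `B` jobs of each pair are started.
theorem card_isInit_le (hR : R.Valid (I.B T) α) (hc : ∀ t i m, S.c t i m ≤ I.Cu) (n : ℕ) :
    ((Finset.Icc 1 n).filter (IsInit I R T S)).card ≤ N * M * I.B T * I.Cu := by
  set F := (Finset.Icc 1 n).filter (IsInit I R T S) with hF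
  rcases F.eq_empty_or_nonempty with he | hne
  · simp [he]
  · set u := F.max' hne with hu
    have hmem := F.max'_mem hne
    rw [← hu] at hmem
    have hu' := Finset.mem_filter.1 hmem
    have hu1 := (Finset.mem_Icc.1 hu'.1).1
    have hsub : F ⊆ Finset.univ.biUnion fun p : Fin N × Fin M =>
        ((Finset.Ico 1 (u + 1)).filter fun s => p ∈ assign I R T S s).biUnion
          fun s => Finset.Ico s (s + I.Cu) := by
      intro t ht
      have htu := F.le_max' t ht
      rw [← hu] at htu
      have ht' := Finset.mem_filter.1 ht
      have ht1 := (Finset.mem_Icc.1 ht'.1).1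
      obtain ⟨p, hp⟩ := occupied_nonempty_of_isInit hR ht1 ht'.2
      refine Finset.mem_biUnion.2 ⟨p, Finset.mem_univ _, ?_⟩
      have hCu := I.one_le_Cl.trans I.Cl_le_Cu
      rcases Finset.mem_union.1 hp with hp | hp
      · exact Finset.mem_biUnion.2 ⟨t, Finset.mem_filter.2
          ⟨Finset.mem_Ico.2 ⟨ht1, by omega⟩, hp⟩, Finset.mem_Ico.2 ⟨le_rfl, by omega⟩⟩
      · obtain ⟨s, h1, h2, h3, h4⟩ := mem_running.1 hp
        have := hc s p.1 p.2
        exact Finset.mem_biUnion.2 ⟨s, Finset.mem_filter.2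
          ⟨Finset.mem_Ico.2 ⟨h1, by omega⟩, h3⟩, Finset.mem_Ico.2 ⟨h2.le, by omega⟩⟩
    calc F.card ≤ _ := Finset.card_le_card hsub
      _ ≤ ∑ p : Fin N × Fin M, _ := Finset.card_biUnion_le
      _ ≤ ∑ _p : Fin N × Fin M, I.B T * I.Cu := by
          refine Finset.sum_le_sum fun p _ => (Finset.card_biUnion_le_card_mul _ _ I.Cu
            fun s _ => by simp).trans (Nat.mul_le_mul_right _ ?_)
          exact started_le_of_isInit hR (t := u + 1) (by omega)
            (fun s _ hs => isInit_of_le (by omega : s ≤ u) hu'.2) p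
      _ = N * M * I.B T * I.Cu := by simp; ring

end Init

open Classical in
/-- The first round of the phase to which round `t` belongs. -/
def phaseStart (I : Instance N M) (R : Routines N M) (T : ℕ) (S : Samples N M) : ℕ → ℕ
  | 0 => 0
  | t + 1 => if NewPhase I R T S (t + 1) then t + 1 else phaseStart I R T S t

theorem phaseStart_of_newPhase {t : ℕ} (ht : 1 ≤ t) (h : NewPhase I R T S t) :
    phaseStart I R T S t = t := by
  obtain ⟨t, rfl⟩ : ∃ u, t = u + 1 := ⟨t - 1, by omega⟩
  simp [phaseStart, h]

theorem phaseStart_of_not_newPhase {t : ℕ} (ht : 1 ≤ t) (h : ¬ NewPhase I R T S t) :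
    phaseStart I R T S t = phaseStart I R T S (t - 1) := by
  obtain ⟨t, rfl⟩ : ∃ u, t = u + 1 := ⟨t - 1, by omega⟩
  simp [phaseStart, h]

/-- Each initialization round schedules the next phase for the following round, and the initial
state schedules it for round `1`. -/
theorem newPhase_of_isInit_pred {t : ℕ} (ht : 1 ≤ t) (h : t = 1 ∨ IsInit I R T S (t - 1)) :
    NewPhase I R T S t := by
  unfold NewPhase
  by_cases h1 : t = 1
  · subst h1
    exact le_rfl
  · rw [(round_init I R T S (by omega) (h.resolve_left h1)).2.2]
    omega

/-- Induction over the rounds after the initialisation, along each phase. -/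
theorem run_induction {p : ℕ → Prop}
    (hnew : ∀ t, 1 ≤ t → ¬ IsInit I R T S t → NewPhase I R T S t →
      (2 ≤ t → ¬ IsInit I R T S (t - 1) → p (t - 1)) → p t)
    (hsame : ∀ t, 1 ≤ t → ¬ IsInit I R T S t → ¬ NewPhase I R T S (t + 1) → p t → p (t + 1)) :
    ∀ t, 1 ≤ t → ¬ IsInit I R T S t → p t := by
  intro t ht
  induction t, ht using Nat.le_induction with
  | base =>
    intro h
    exact hnew 1 le_rfl h (newPhase_of_isInit_pred le_rfl (Or.inl rfl)) fun h => by omega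
  | succ t ht ih =>
    intro h
    by_cases hn : NewPhase I R T S (t + 1)
    · exact hnew _ (by omega) h hn fun _ h' => ih h'
    · have hI : ¬ IsInit I R T S t := fun hI =>
        hn (newPhase_of_isInit_pred (by omega) (Or.inr hI))
      exact hsame t ht hI hn (ih hI)

/-- These facts hold when a phase opens and persist until it ends, because plan and scheduled end
are then left untouched. The positive phase length makes the last inequality strict. -/
theorem phaseStart_spec : ∀ t, 1 ≤ t → ¬ IsInit I R T S t →
    1 ≤ phaseStart I R T S t ∧ phaseStart I R T S t ≤ t ∧
    ¬ IsInit I R T S (phaseStart I R T S t) ∧ NewPhase I R T S (phaseStart I R T S t) ∧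
    planAt I R T S t = planAt I R T S (phaseStart I R T S t) ∧
    nextAt I R T S t = phaseStart I R T S t
      + phaseLength S (assign I R T S) (phaseStart I R T S t) I ∧
    t < nextAt I R T S t := by
  refine run_induction (fun t ht hI hn _ => ?_) fun t ht hI hn ih => ?_
  · rw [phaseStart_of_newPhase ht hn]
    refine ⟨ht, le_rfl, hI, hn, rfl, (round_newPhase I R T S ht hI hn).2, ?_⟩
    rw [(round_newPhase I R T S ht hI hn).2]
    have := I.one_le_Cl.trans I.Cl_le_Cu
    unfold phaseLength
    omega
  · have hI' : ¬ IsInit I R T S (t + 1) := fun h => hI (isInit_of_le (Nat.le_succ t) h)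
    obtain ⟨h1, h2, h3, h4, h5, h6, h7⟩ := ih
    obtain ⟨e1, e2⟩ := round_samePhase I R T S (by omega) hI' hn
    rw [phaseStart_of_not_newPhase (by omega) hn, e1, e2]
    simp only [Nat.add_sub_cancel]
    refine ⟨h1, by omega, h3, h4, h5, h6, ?_⟩
    unfold NewPhase at hn
    simpa using hn

theorem phaseStart_eq_of_lt_next {t s : ℕ} (hI : ¬ IsInit I R T S t) (hts : t ≤ s)
    (hs : s < nextAt I R T S t) : phaseStart I R T S s = phaseStart I R T S t ∧
      planAt I R T S s = planAt I R T S t ∧ nextAt I R T S s = nextAt I R T S t := by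
  induction s, hts using Nat.le_induction with
  | base => exact ⟨rfl, rfl, rfl⟩
  | succ s hts ih =>
    obtain ⟨e1, e2, e3⟩ := ih (by omega)
    have hn : ¬ NewPhase I R T S (s + 1) := by
      unfold NewPhase
      simp only [Nat.add_sub_cancel, e3]
      omega
    obtain ⟨e4, e5⟩ := round_samePhase I R T S (by omega : 1 ≤ s + 1)
      (fun h => hI (isInit_of_le (by omega) h)) hn
    rw [phaseStart_of_not_newPhase (by omega) hn, e4, e5]
    simp only [Nat.add_sub_cancel]
    exact ⟨e1, e2, e3⟩

theorem two_mul_Cu_le_phaseLength (A : ℕ → Assignment N M) (t : ℕ) :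
    2 * I.Cu ≤ phaseLength S A t I := Nat.le_add_left _ _

theorem planAt_eq_of_mem_phase {t s : ℕ} (ht : 1 ≤ t) (hI : ¬ IsInit I R T S t)
    (h1 : phaseStart I R T S t ≤ s) (h2 : s < nextAt I R T S t) :
    phaseStart I R T S s = phaseStart I R T S t ∧ planAt I R T S s = planAt I R T S t := by
  obtain ⟨g1, g2, g3, g4, g5, g6, g7⟩ := phaseStart_spec t ht hI
  have hnext : nextAt I R T S (phaseStart I R T S t) = nextAt I R T S t := by
    rw [g6, (round_newPhase I R T S g1 g3 g4).2]
  obtain ⟨e1, e2, e3⟩ := phaseStart_eq_of_lt_next g3 h1 (by omega)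
  rw [phaseStart_of_newPhase g1 g4] at e1
  exact ⟨e1, by rw [e2, g5]⟩

theorem assign_subset_planAt {t : ℕ} (ht : 1 ≤ t) (hI : ¬ IsInit I R T S t) :
    assign I R T S t ⊆ planAt I R T S t := by
  rw [round_run I R T S ht hI]
  split_ifs
  · exact Finset.sdiff_subset
  · exact Finset.empty_subset _

theorem occupied_eq_planAt {t : ℕ} (ht : 1 ≤ t) (hI : ¬ IsInit I R T S t)
    (h : running S (assign I R T S) t ⊆ planAt I R T S t) :
    occupied I R T S t = planAt I R T S t := by
  rw [occupied, round_run I R T S ht hI, if_pos h, Finset.sdiff_union_of_subset h]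

theorem occupied_eq_running {t : ℕ} (ht : 1 ≤ t) (hI : ¬ IsInit I R T S t)
    (h : ¬ running S (assign I R T S) t ⊆ planAt I R T S t) :
    occupied I R T S t = running S (assign I R T S) t := by
  rw [occupied, round_run I R T S ht hI, if_neg h, Finset.empty_union]

/-- After the transition at the beginning of a phase, the plan of the phase is executed. -/
theorem running_subset_planAt (hc : ∀ t i m, S.c t i m ≤ I.Cu) {t : ℕ} (ht : 1 ≤ t)
    (hI : ¬ IsInit I R T S t) (h : phaseStart I R T S t + I.Cu ≤ t) :
    running S (assign I R T S) t ⊆ planAt I R T S t := by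
  intro p hp
  obtain ⟨s, h1, h2, h3, h4⟩ := mem_running.1 hp
  have := hc s p.1 p.2
  obtain ⟨g1, g2, g3, g4, g5, g6, g7⟩ := phaseStart_spec t ht hI
  -- A job still running was started less than `C_u` rounds ago, hence within the present phase and
  -- from its plan.
  have hs := (planAt_eq_of_mem_phase ht hI (s := s) (by omega) (by omega)).2
  rw [← hs]
  exact assign_subset_planAt h1 (fun h => g3 (isInit_of_le (by omega) h)) h3

theorem occupied_eq_planAt_of_le (hc : ∀ t i m, S.c t i m ≤ I.Cu) {t : ℕ} (ht : 1 ≤ t)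
    (hI : ¬ IsInit I R T S t) (h : phaseStart I R T S t + I.Cu ≤ t) :
    occupied I R T S t = planAt I R T S t :=
  occupied_eq_planAt ht hI (running_subset_planAt hc ht hI h)

theorem next_le_of_newPhase {t u : ℕ} (ht : 1 ≤ t) (hI : ¬ IsInit I R T S t) (htu : t < u)
    (hu : NewPhase I R T S u) : nextAt I R T S t ≤ u := by
  by_contra h
  have e := (phaseStart_eq_of_lt_next hI htu.le (by omega)).1
  rw [phaseStart_of_newPhase (by omega) hu] at e
  have := (phaseStart_spec t ht hI).2.1
  omega

theorem next_ge {t : ℕ} (ht : 1 ≤ t) (hI : ¬ IsInit I R T S t) :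
    phaseStart I R T S t + 2 * I.Cu ≤ nextAt I R T S t := by
  rw [(phaseStart_spec t ht hI).2.2.2.2.2.1]
  exact Nat.add_le_add_left (two_mul_Cu_le_phaseLength _ _) _

/-- The jobs executed after the initialisation follow the plan of the current phase or, during
the transition, that of the previous phase. -/
theorem occupied_subset {α : ℝ} (hR : R.Valid (I.B T) α) (hc : ∀ t i m, S.c t i m ≤ I.Cu) :
    ∀ t, 1 ≤ t → ¬ IsInit I R T S t → occupied I R T S t ⊆ planAt I R T S t ∨
      (t < phaseStart I R T S t + I.Cu ∧ 2 ≤ phaseStart I R T S t ∧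
        ¬ IsInit I R T S (phaseStart I R T S t - 1) ∧
        occupied I R T S t ⊆ planAt I R T S (phaseStart I R T S t - 1)) := by
  have hCu : 1 ≤ I.Cu := I.one_le_Cl.trans I.Cl_le_Cu
  refine run_induction (fun t ht hI hn ih => ?_) fun t ht hI hn ih => ?_
  · by_cases hb : running S (assign I R T S) t ⊆ planAt I R T S t
    · exact Or.inl (occupied_eq_planAt ht hI hb).subset
    right
    have hpred : ¬ (t = 1 ∨ IsInit I R T S (t - 1)) := fun h => hb (by
      rw [running_eq_empty_of_isInit_pred hR ht hI h]; exact Finset.empty_subset _)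
    rw [not_or] at hpred
    rw [phaseStart_of_newPhase ht hn]
    refine ⟨by omega, by omega, hpred.2, ?_⟩
    rw [occupied_eq_running ht hI hb]
    have hsub : running S (assign I R T S) t ⊆ occupied I R T S (t - 1) := by
      have := running_succ_subset_occupied (I := I) (R := R) (T := T) (S := S) (t - 1)
      rwa [Nat.sub_add_cancel ht] at this
    refine hsub.trans ?_
    rcases ih (by omega) hpred.2 with h | h
    · exact h
    -- The previous phase lasted at least `2 C_u` rounds, so its own transition was over in its last
    -- round.
    · exfalso
      have h1 := next_ge (by omega) hpred.2
      have h2 := next_le_of_newPhase (by omega) hpred.2 (by omega) hn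
      omega
  · have hI' : ¬ IsInit I R T S (t + 1) := fun h => hI (isInit_of_le (Nat.le_succ t) h)
    by_cases hb : running S (assign I R T S) (t + 1) ⊆ planAt I R T S (t + 1)
    · exact Or.inl (occupied_eq_planAt (by omega) hI' hb).subset
    right
    have hlt : t + 1 < phaseStart I R T S (t + 1) + I.Cu := by
      by_contra hge
      exact hb (running_subset_planAt hc (by omega) hI' (by omega))
    rw [occupied_eq_running (by omega) hI' hb]
    rw [phaseStart_of_not_newPhase (by omega) hn] at hlt ⊢
    rw [(round_samePhase I R T S (by omega) hI' hn).1] at hb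
    simp only [Nat.add_sub_cancel] at hlt hb ⊢
    have hsub := running_succ_subset_occupied (I := I) (R := R) (T := T) (S := S) t
    rcases ih with h | ⟨-, h2, h3, h4⟩
    -- Once the active jobs fit the plan they keep fitting it within the phase, so a misfit now
    -- means that the transition has not ended.
    · exact absurd (hsub.trans h) hb
    · exact ⟨hlt, h2, h3, hsub.trans h4⟩

theorem planAt_zero : planAt I R T S 0 = ∅ := rfl

/-- The excess of a round after the initialisation is controlled by the gaps of two plans. -/
theorem excess_le_of_not_isInit {α : ℝ} (hR : R.Valid (I.B T) α)
    (hc : ∀ t i m, S.c t i m ≤ I.Cu) {t : ℕ} (ht : 1 ≤ t) (hI : ¬ IsInit I R T S t) :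
    I.excess (assign I R T S t) (running S (assign I R T S) t)
      ≤ I.gap (planAt I R T S t) + I.gap (planAt I R T S (t - I.Cu)) := by
  have hd := assign_disjoint_running (I := I) (S := S) hR ht
  rcases occupied_subset hR hc t ht hI with h | ⟨h1, h2, h3, h4⟩
  · have := I.excess_le_gap hd h
    linarith [I.gap_nonneg (planAt I R T S (t - I.Cu))]
  · have := I.excess_le_gap hd h4
    have hn := (phaseStart_spec t ht hI).2.2.2.1
    have hle := (phaseStart_spec t ht hI).2.1
    have h5 := next_ge (by omega) h3
    have h6 := next_le_of_newPhase (by omega) h3 (by omega) hn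
    have h7 := (phaseStart_spec _ (by omega) h3).2.2.2.2.2.2
    -- Going back `C_u` rounds from a transition leaves the current phase but, by the minimal length
    -- `2 C_u`, not the previous one.
    have e := (planAt_eq_of_mem_phase (s := t - I.Cu) (by omega) h3 (by omega) (by omega)).2
    rw [← e] at this
    linarith [I.gap_nonneg (planAt I R T S t)]

theorem planAt_mem_estFeasible {α : ℝ} (hR : R.Valid (I.B T) α) {t : ℕ} (ht : 1 ≤ t)
    (hI : ¬ IsInit I R T S t) : planAt I R T S t
      ∈ estFeasible S (assign I R T S) (phaseStart I R T S t) I := by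
  obtain ⟨g1, g2, g3, g4, g5, -, -⟩ := phaseStart_spec t ht hI
  -- The empty assignment always looks feasible since capacities are nonnegative, so the plan always
  -- comes from the oracle.
  have hne : (estFeasible S (assign I R T S) (phaseStart I R T S t) I).Nonempty := by
    refine ⟨∅, Finset.mem_filter.2 ⟨empty_mem_possible, fun m => ?_⟩⟩
    simpa [lcb, radF, entry] using I.L_nonneg m
  rw [g5, (round_newPhase I R T S g1 g3 g4).1, choosePlan, if_pos hne]
  exact hR.oracle_mem _ _ hne

theorem planAt_possible {α : ℝ} (hR : R.Valid (I.B T) α) {t : ℕ} (ht : 1 ≤ t)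
    (hI : ¬ IsInit I R T S t) : planAt I R T S t ∈ possible N M :=
  (Finset.mem_filter.1 (planAt_mem_estFeasible hR ht hI)).1

theorem totalExcess_eq : totalExcess I R T S = ∑ t ∈ Finset.Icc 1 T,
    I.excess (assign I R T S t) (running S (assign I R T S) t) := rfl

open Classical in
theorem totalExcess_le {α : ℝ} (hR : R.Valid (I.B T) α) (hc : ∀ t i m, S.c t i m ≤ I.Cu) :
    totalExcess I R T S ≤ N * (N * M * I.B T * I.Cu : ℕ)
      + 2 * ∑ t ∈ (Finset.Icc 1 T).filter (¬ IsInit I R T S ·), I.gap (planAt I R T S t) := by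
  have hg : ∀ t, 0 ≤ I.gap (planAt I R T S t) := fun t => I.gap_nonneg _
  -- Initialization rounds contribute nothing, their plan being empty.
  have hplan : ∑ t ∈ (Finset.Icc 1 T).filter (¬ IsInit I R T S ·), I.gap (planAt I R T S t)
      = ∑ t ∈ Finset.Icc 1 T, I.gap (planAt I R T S t) := by
    refine Finset.sum_filter_of_ne fun t ht hne hI => hne ?_
    rw [(round_init I R T S (Finset.mem_Icc.1 ht).1 hI).2.1, I.gap_empty]
  have hshift : ∑ t ∈ Finset.Icc 1 T, I.gap (planAt I R T S (t - I.Cu))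
      ≤ ∑ t ∈ Finset.Icc 1 T, I.gap (planAt I R T S t) := by
    -- For `t ≤ C_u` the truncated difference is `0`, where the plan is empty; on the other rounds
    -- the shift is injective.
    rw [← Finset.sum_filter_of_ne (p := fun t => I.Cu < t)
      (fun t ht hne => by
        by_contra h
        rw [Nat.sub_eq_zero_of_le (not_lt.1 h), planAt_zero, I.gap_empty] at hne
        exact hne rfl)]
    have hinj : Set.InjOn (fun t => t - I.Cu)
        ((Finset.Icc 1 T).filter fun t => I.Cu < t : Finset ℕ) := by
      intro a ha b hb hab
      simp only [Finset.coe_filter, Finset.mem_Icc, Set.mem_ofPred_eq] at ha hb hab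
      omega
    rw [← Finset.sum_image (g := fun t => t - I.Cu) (f := fun t => I.gap (planAt I R T S t)) hinj]
    refine Finset.sum_le_sum_of_subset_of_nonneg ?_ fun t _ _ => hg t
    intro t ht
    obtain ⟨u, hu, rfl⟩ := Finset.mem_image.1 ht
    simp only [Finset.mem_filter, Finset.mem_Icc] at hu ⊢
    omega
  rw [totalExcess_eq, ← Finset.sum_filter_add_sum_filter_not _ (IsInit I R T S)]
  refine add_le_add ?_ ?_
  · calc _ ≤ ∑ t ∈ (Finset.Icc 1 T).filter (IsInit I R T S), (N : ℝ) := by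
          refine Finset.sum_le_sum fun t ht => ?_
          have ht' := Finset.mem_filter.1 ht
          have ht1 := (Finset.mem_Icc.1 ht'.1).1
          exact (I.excess_le_gap (assign_disjoint_running hR ht1) (Finset.Subset.refl _)).trans
            (I.gap_le (occupied_possible_of_isInit hR ht1 ht'.2))
      _ = N * (((Finset.Icc 1 T).filter (IsInit I R T S)).card : ℝ) := by
          rw [Finset.sum_const, nsmul_eq_mul, mul_comm]
      _ ≤ _ := by
          gcongr
          exact card_isInit_le hR hc T
  · calc _ ≤ ∑ t ∈ (Finset.Icc 1 T).filter (¬ IsInit I R T S ·),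
            (I.gap (planAt I R T S t) + I.gap (planAt I R T S (t - I.Cu))) := by
          refine Finset.sum_le_sum fun t ht => ?_
          have ht' := Finset.mem_filter.1 ht
          exact excess_le_of_not_isInit hR hc (Finset.mem_Icc.1 ht'.1).1 ht'.2
      _ ≤ ∑ t ∈ Finset.Icc 1 T,
            (I.gap (planAt I R T S t) + I.gap (planAt I R T S (t - I.Cu))) :=
          Finset.sum_le_sum_of_subset_of_nonneg (Finset.filter_subset _ _)
            fun t _ _ => add_nonneg (hg _) (hg _)
      _ ≤ _ := by
          rw [hplan, Finset.sum_add_distrib]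
          linarith

end Phases

/-! ### Counting the rounds with an infeasible plan -/

section Counting

variable {N M : ℕ} {I : Instance N M} {R : Routines N M} {T : ℕ} {S : Samples N M} {α : ℝ}

theorem mean_sub_fhat_le {t : ℕ} {p : Fin N × Fin M} (ht : 1 ≤ t)
    (hn : 1 ≤ nExec S (assign I R T S) t p) (hu : ¬ Underestimated I R T S t p) :
    I.fbar p.1 p.2 - fhat S (assign I R T S) t p
      ≤ Real.sqrt (1.5 * Real.log t / nExec S (assign I R T S) t p) := by
  set n := nExec S (assign I R T S) t p with hn'
  have hlog : 0 ≤ Real.log t := Real.log_nonneg (by exact_mod_cast ht)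
  have hnR : (0 : ℝ) < n := by exact_mod_cast hn
  have h : n * (I.fbar p.1 p.2 - fhat S (assign I R T S) t p)
      ≤ Real.sqrt (1.5 * Real.log t * n) := by
    refine le_trans (le_of_eq ?_) (not_lt.1 hu)
    have hcard : ((execRounds S (assign I R T S) t p).card : ℝ) = n := rfl
    rw [Finset.sum_sub_distrib, Finset.sum_const, nsmul_eq_mul, hcard, mul_sub, fhat, ← hn']
    field_simp
  have hsq : Real.sqrt (1.5 * Real.log t * n) = n * Real.sqrt (1.5 * Real.log t / n) := by
    rw [show 1.5 * Real.log t * (n : ℝ) = n ^ 2 * (1.5 * Real.log t / n) by field_simp,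
      Real.sqrt_mul (by positivity), Real.sqrt_sq hnR.le]
  rw [hsq] at h
  exact le_of_mul_le_mul_left h hnR

/-- If no mean consumption is underestimated, then an infeasible assignment that looks feasible
contains a rarely executed pair. -/
theorem exists_nExec_le {t : ℕ} (ht : 1 ≤ t) (hL : 1 ≤ I.Lbar) {a : Assignment N M}
    (ha : a ∈ estFeasible S (assign I R T S) t I) (hinf : a ∈ I.infeasible)
    (hn : ∀ p, 1 ≤ nExec S (assign I R T S) t p) (hu : ∀ p, ¬ Underestimated I R T S t p) :
    ∃ p ∈ a, (nExec S (assign I R T S) t p : ℝ) ≤ 1.5 * (N + 1) ^ 2 *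
      ((I.Lbar : ℝ) ^ 2 * Real.log t / (⨆ m, I.gapAgent a m) ^ 2) := by
  set A := assign I R T S
  have hlog : 0 ≤ Real.log t := Real.log_nonneg (by exact_mod_cast ht)
  have hLR : (1 : ℝ) ≤ I.Lbar := by exact_mod_cast hL
  obtain ⟨m0, hm0⟩ : ∃ m, I.L m < ∑ i, I.fbar i m * entry a i m := by
    have h := Finset.mem_sdiff.1 hinf
    by_contra! hcon
    exact h.2 (Finset.mem_filter.2 ⟨h.1, hcon⟩)
  have : Nonempty (Fin M) := ⟨m0⟩
  -- The agent with the largest violation; its least executed task in `a` provides the required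
  -- pair.
  obtain ⟨m, hm⟩ := exists_eq_ciSup_of_finite (f := fun m => I.gapAgent a m)
  set D := ⨆ m, I.gapAgent a m with hD
  have hDpos : 0 < D := by
    have h1 : I.gapAgent a m0 ≤ D := le_ciSup (Set.finite_range _).bddAbove m0
    have h2 : 0 < I.gapAgent a m0 := lt_max_of_lt_left (by linarith)
    linarith
  have hDeq : D = ∑ i, I.fbar i m * entry a i m - I.L m := by
    have h : max (∑ i, I.fbar i m * entry a i m - I.L m) 0 = D := hm
    rcases le_total (∑ i, I.fbar i m * entry a i m - I.L m) 0 with h' | h'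
    · rw [max_eq_right h'] at h
      linarith
    · rw [max_eq_left h'] at h
      exact h.symm
  have hex : ∃ i, (i, m) ∈ a := by
    by_contra! hcon
    have : ∑ i, I.fbar i m * entry a i m = 0 :=
      Finset.sum_eq_zero fun i _ => by simp [entry, hcon i]
    linarith [I.L_nonneg m]
  have : Nonempty {i : Fin N // (i, m) ∈ a} := ⟨⟨hex.choose, hex.choose_spec⟩⟩
  obtain ⟨i0, hi0⟩ := exists_eq_ciInf_of_finite
    (f := fun i : {i : Fin N // (i, m) ∈ a} => nExec S A t (i.1, m))
  set n := ⨅ i : {i : Fin N // (i, m) ∈ a}, nExec S A t (i.1, m) with hndef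
  have hn1 : 1 ≤ n := hi0 ▸ hn (i0.1, m)
  have hnR : (0 : ℝ) < n := by exact_mod_cast hn1
  refine ⟨(i0.1, m), i0.2, ?_⟩
  rw [hi0]
  set ρ := Real.sqrt (1.5 * Real.log t / n) with hρ
  have hρ0 : 0 ≤ ρ := Real.sqrt_nonneg _
  have hrad : radF S A t I a m = I.Lbar * ρ := by
    rw [radF, if_pos hex, ← hndef, hρ,
      show 1.5 * (I.Lbar : ℝ) ^ 2 * Real.log t / n = (I.Lbar : ℝ) ^ 2 * (1.5 * Real.log t / n) by
        ring, Real.sqrt_mul (by positivity), Real.sqrt_sq (by positivity)]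
  have hlcb : ∑ i, fhat S A t (i, m) * entry a i m - I.Lbar * ρ ≤ I.L m := by
    rw [← hrad]
    exact (Finset.mem_filter.1 ha).2 m
  -- An infeasible assignment may contain more than `L̄` tasks, so the errors are summed over all
  -- `N`. With the radius `L̄ ρ` this gives a width of at most `(N + 1) L̄ ρ`, since `L̄ ≥ 1`.
  have hdev : ∑ i, I.fbar i m * entry a i m - ∑ i, fhat S A t (i, m) * entry a i m ≤ N * ρ := by
    rw [← Finset.sum_sub_distrib]
    calc _ ≤ ∑ _i : Fin N, ρ := by
          refine Finset.sum_le_sum fun i _ => ?_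
          by_cases hi : (i, m) ∈ a
          · have h1 := mean_sub_fhat_le ht (hn (i, m)) (hu (i, m))
            have h2 : n ≤ nExec S A t (i, m) :=
              ciInf_le' (fun i : {i : Fin N // (i, m) ∈ a} => nExec S A t (i.1, m)) ⟨i, hi⟩
            simp only [entry, hi, if_true, mul_one]
            refine h1.trans (Real.sqrt_le_sqrt ?_)
            gcongr
          · simpa [entry, hi] using hρ0
      _ = N * ρ := by simp
  have hDle : D ≤ (N + 1) * I.Lbar * ρ := by
    have : (N : ℝ) * ρ ≤ N * I.Lbar * ρ := by
      rw [mul_assoc]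
      gcongr
      exact le_mul_of_one_le_left hρ0 hLR
    nlinarith
  have hD2 : D ^ 2 ≤ ((N + 1) * I.Lbar) ^ 2 * (1.5 * Real.log t / n) := by
    calc D ^ 2 ≤ ((N + 1) * I.Lbar * ρ) ^ 2 := by gcongr
      _ = _ := by rw [mul_pow, hρ, Real.sq_sqrt (by positivity)]
  rw [← mul_div_assoc] at hD2
  rw [le_div_iff₀ hnR] at hD2
  rw [← mul_div_assoc, le_div_iff₀ (by positivity)]
  linarith

/-- The minimum over pairs is at most the value at `p`, and each completed job of `p` occupies at
least `C_l` rounds of its own. -/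
theorem phaseLength_le (hR : R.Valid (I.B T) α) (hc : ∀ t i m, I.Cl ≤ S.c t i m) (t : ℕ)
    (p : Fin N × Fin M) : phaseLength S (assign I R T S) t I
      ≤ nExec S (assign I R T S) t p + 2 * I.Cu := by
  unfold phaseLength
  refine Nat.add_le_add_right (le_trans (Nat.mul_le_mul_left _ (ciInf_le' _ p)) ?_) _
  exact mul_nJobs_le_nExec hc fun s hs => assign_disjoint_running hR hs

open Classical in
/-- The number of rounds in the phases that plan to execute the pair `p`, as long as `p` has been
executed in at most `X` rounds when the phase begins. -/
theorem card_rare_rounds_le (hR : R.Valid (I.B T) α)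
    (hc : ∀ t i m, I.Cl ≤ S.c t i m ∧ S.c t i m ≤ I.Cu) (p : Fin N × Fin M) {X : ℝ}
    (hX : 0 ≤ X) (n : ℕ) :
    (((Finset.Icc 1 n).filter fun t => ¬ IsInit I R T S t ∧ p ∈ planAt I R T S t ∧
      (nExec S (assign I R T S) (phaseStart I R T S t) p : ℝ) ≤ X).card : ℝ)
      ≤ 3 * X + 2 * I.Cu := by
  set Q := (Finset.Icc 1 n).filter fun t => ¬ IsInit I R T S t ∧ p ∈ planAt I R T S t ∧
      (nExec S (assign I R T S) (phaseStart I R T S t) p : ℝ) ≤ X with hQ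
  rcases Q.eq_empty_or_nonempty with he | hne
  · rw [he]
    simp only [Finset.card_empty, Nat.cast_zero]
    positivity
  have hmem := Q.max'_mem hne
  set u := Q.max' hne with hu
  have hQmem : ∀ t ∈ Q, 1 ≤ t ∧ ¬ IsInit I R T S t ∧ p ∈ planAt I R T S t := fun t ht => by
    have ht' := Finset.mem_filter.1 ht
    exact ⟨(Finset.mem_Icc.1 ht'.1).1, ht'.2.1, ht'.2.2.1⟩
  obtain ⟨hu1, huI, -⟩ := hQmem u hmem
  have huX := (Finset.mem_filter.1 hmem).2.2.2
  obtain ⟨g1, g2, g3, g4, -, g6, g7⟩ := phaseStart_spec u hu1 huI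
  set φ := phaseStart I R T S u
  have hlen := phaseLength_le hR (fun t i m => (hc t i m).1) φ p
  set E := execRounds S (assign I R T S) φ p with hE
  have hEc : E.card = nExec S (assign I R T S) φ p := rfl
  -- `φ` starts the last phase that meets `Q`. An earlier round of `Q` executes `p` if its
  -- transition is over; otherwise `p` is executed `C_u` rounds later, still in the same phase. Both
  -- sets have at most `E.card ≤ X` elements, and the last phase adds at most `E.card + 2 C_u`
  -- rounds.
  have hsub : Q ⊆ E ∪ ((Finset.range φ).filter fun t => t + I.Cu ∈ E)
      ∪ Finset.Ico φ (φ + phaseLength S (assign I R T S) φ I) := by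
    intro t ht
    obtain ⟨ht1, htI, htp⟩ := hQmem t ht
    have htu : t ≤ u := Q.le_max' t ht
    by_cases htφ : φ ≤ t
    · refine Finset.mem_union_right _ (Finset.mem_Ico.2 ⟨htφ, by omega⟩)
    refine Finset.mem_union_left _ ?_
    rw [not_le] at htφ
    by_cases hto : phaseStart I R T S t + I.Cu ≤ t
    · refine Finset.mem_union_left _ (mem_execRounds.2 ⟨ht1, htφ, ?_⟩)
      have := occupied_eq_planAt_of_le (fun t i m => (hc t i m).2) ht1 htI hto
      rw [← this] at htp
      exact htp
    · refine Finset.mem_union_right _ (Finset.mem_filter.2 ⟨Finset.mem_range.2 htφ, ?_⟩)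
      have hle := (phaseStart_spec t ht1 htI).2.1
      have h1 := next_ge ht1 htI
      have h2 := next_le_of_newPhase ht1 htI htφ g4
      obtain ⟨e1, e2⟩ := planAt_eq_of_mem_phase (s := t + I.Cu) ht1 htI (by omega) (by omega)
      refine mem_execRounds.2 ⟨by omega, by omega, ?_⟩
      have := occupied_eq_planAt_of_le (fun t i m => (hc t i m).2) (t := t + I.Cu) (by omega)
        (fun h => htI (isInit_of_le (by omega) h)) (by omega)
      rw [← e2, ← this] at htp
      exact htp
  have hshift : ((Finset.range φ).filter fun t => t + I.Cu ∈ E).card ≤ E.card :=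
    Finset.card_le_card_of_injOn (fun t => t + I.Cu)
      (fun t ht => (Finset.mem_filter.1 ht).2) fun a _ b _ hab => by simpa using hab
  have hcard : Q.card ≤ 3 * nExec S (assign I R T S) φ p + 2 * I.Cu := by
    have h1 := Finset.card_le_card hsub
    have h2 := Finset.card_union_le (E ∪ ((Finset.range φ).filter fun t => t + I.Cu ∈ E))
      (Finset.Ico φ (φ + phaseLength S (assign I R T S) φ I))
    have h3 := Finset.card_union_le E ((Finset.range φ).filter fun t => t + I.Cu ∈ E)
    rw [Nat.card_Ico, Nat.add_sub_cancel_left] at h2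
    omega
  calc (Q.card : ℝ) ≤ 3 * nExec S (assign I R T S) φ p + 2 * I.Cu := by exact_mod_cast hcard
    _ ≤ _ := by linarith

open Classical in
-- No pair has more than `φ` executions before round `φ`. This linear bound is affordable because
-- underestimation at `φ` has probability at most `φ⁻²`.
theorem card_phase_le [Nonempty (Fin N × Fin M)] (hR : R.Valid (I.B T) α)
    (hc : ∀ t i m, I.Cl ≤ S.c t i m) (n φ : ℕ) :
    ((Finset.Icc 1 n).filter fun t => ¬ IsInit I R T S t ∧ phaseStart I R T S t = φ).card
      ≤ φ + 2 * I.Cu := by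
  obtain ⟨p⟩ := ‹Nonempty (Fin N × Fin M)›
  have hsub : ((Finset.Icc 1 n).filter fun t => ¬ IsInit I R T S t ∧ phaseStart I R T S t = φ)
      ⊆ Finset.Ico φ (φ + phaseLength S (assign I R T S) φ I) := by
    intro t ht
    obtain ⟨h1, h2, rfl⟩ := Finset.mem_filter.1 ht
    obtain ⟨-, g2, -, -, -, g6, g7⟩ := phaseStart_spec t (Finset.mem_Icc.1 h1).1 h2
    exact Finset.mem_Ico.2 ⟨g2, by omega⟩
  refine (Finset.card_le_card hsub).trans ?_
  rw [Nat.card_Ico, Nat.add_sub_cancel_left]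
  exact (phaseLength_le hR hc φ p).trans (Nat.add_le_add_right nExec_le _)

open Classical in
/-- The sum of the gaps of the plans over the rounds after the initialisation. -/
theorem sum_gap_planAt_le [Nonempty (Fin N × Fin M)] (hR : R.Valid (I.B T) α)
    (hc : ∀ t i m, I.Cl ≤ S.c t i m ∧ S.c t i m ≤ I.Cu) (hB : 1 ≤ I.B T) (hL : 1 ≤ I.Lbar)
    {Y : ℝ} (hY0 : 0 ≤ Y) (hY : ∀ a ∈ I.infeasible,
      (I.Lbar : ℝ) ^ 2 * Real.log T / (⨆ m, I.gapAgent a m) ^ 2 ≤ Y) :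
    ∑ t ∈ (Finset.Icc 1 T).filter (¬ IsInit I R T S ·), I.gap (planAt I R T S t)
      ≤ N * (N * M * (3 * (1.5 * (N + 1) ^ 2 * Y) + 2 * I.Cu)
        + ∑ φ ∈ Finset.Icc 1 T, ∑ p : Fin N × Fin M,
          if Underestimated I R T S φ p then (φ + 2 * I.Cu : ℝ) else 0) := by
  set X := 1.5 * ((N : ℝ) + 1) ^ 2 * Y with hX
  have hX0 : 0 ≤ X := by positivity
  set F := (Finset.Icc 1 T).filter (¬ IsInit I R T S ·) with hF
  let bad : ℕ → Fin N × Fin M → ℝ := fun t p =>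
    if Underestimated I R T S (phaseStart I R T S t) p then 1 else 0
  let rare : ℕ → Fin N × Fin M → ℝ := fun t p => if p ∈ planAt I R T S t ∧
    (nExec S (assign I R T S) (phaseStart I R T S t) p : ℝ) ≤ X then 1 else 0
  have hbad0 : ∀ t p, 0 ≤ bad t p := fun t p => by simp only [bad]; split_ifs <;> norm_num
  have hrare0 : ∀ t p, 0 ≤ rare t p := fun t p => by simp only [rare]; split_ifs <;> norm_num
  have hround : ∀ t ∈ F, I.gap (planAt I R T S t) ≤ N * (∑ p, rare t p + ∑ p, bad t p) := by
    intro t ht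
    have ht' := Finset.mem_filter.1 ht
    obtain ⟨ht1, htT⟩ := Finset.mem_Icc.1 ht'.1
    have hposs := planAt_possible hR ht1 ht'.2
    have hs1 : 0 ≤ ∑ p, rare t p := Finset.sum_nonneg fun p _ => hrare0 t p
    have hs2 : 0 ≤ ∑ p, bad t p := Finset.sum_nonneg fun p _ => hbad0 t p
    by_cases hfeas : planAt I R T S t ∈ I.feasible
    · rw [I.gap_eq_zero hfeas]
      positivity
    refine (I.gap_le hposs).trans (le_mul_of_one_le_right (Nat.cast_nonneg _) ?_)
    by_cases hb : ∃ p, Underestimated I R T S (phaseStart I R T S t) p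
    · obtain ⟨p, hp⟩ := hb
      have h1 : bad t p = 1 := if_pos hp
      have h2 := Finset.single_le_sum (f := bad t) (fun q _ => hbad0 t q) (Finset.mem_univ p)
      linarith
    · obtain ⟨g1, g2, g3, -, -, -, -⟩ := phaseStart_spec t ht1 ht'.2
      have hinf : planAt I R T S t ∈ I.infeasible := Finset.mem_sdiff.2 ⟨hposs, hfeas⟩
      obtain ⟨p, hp, hpX⟩ := exists_nExec_le g1 hL (planAt_mem_estFeasible hR ht1 ht'.2) hinf
        -- The initialization is over when the phase starts, so each pair has at least `B ≥ 1`
        -- completed jobs.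
        (fun p => by
          refine le_trans ?_ nJobs_le_nExec
          by_contra h
          exact g3 ⟨p, by omega⟩) (not_exists.1 hb)
      have hpX' : (nExec S (assign I R T S) (phaseStart I R T S t) p : ℝ) ≤ X := by
        refine hpX.trans ?_
        rw [hX]
        refine mul_le_mul_of_nonneg_left (le_trans ?_ (hY _ hinf)) (by positivity)
        gcongr
        exact_mod_cast g2.trans htT
      have h1 : rare t p = 1 := if_pos ⟨hp, hpX'⟩
      have h2 := Finset.single_le_sum (f := rare t) (fun q _ => hrare0 t q) (Finset.mem_univ p)
      linarith
  have hrare : ∑ t ∈ F, ∑ p, rare t p ≤ N * M * (3 * X + 2 * I.Cu) := by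
    rw [Finset.sum_comm]
    calc _ ≤ ∑ _p : Fin N × Fin M, (3 * X + 2 * (I.Cu : ℝ)) := by
          refine Finset.sum_le_sum fun p _ => ?_
          refine le_trans (le_of_eq ?_) (card_rare_rounds_le hR hc p hX0 T)
          simp only [rare, Finset.sum_boole, hF, Finset.filter_filter]
      _ = _ := by
          rw [Finset.sum_const, nsmul_eq_mul]
          simp
  have hbadsum : ∑ t ∈ F, ∑ p, bad t p ≤ ∑ φ ∈ Finset.Icc 1 T, ∑ p : Fin N × Fin M,
      if Underestimated I R T S φ p then (φ + 2 * I.Cu : ℝ) else 0 := by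
    have hmaps : ∀ t ∈ F, phaseStart I R T S t ∈ Finset.Icc 1 T := by
      intro t ht
      have ht' := Finset.mem_filter.1 ht
      obtain ⟨ht1, htT⟩ := Finset.mem_Icc.1 ht'.1
      obtain ⟨g1, g2, -⟩ := phaseStart_spec t ht1 ht'.2
      exact Finset.mem_Icc.2 ⟨g1, g2.trans htT⟩
    -- Rounds are grouped by the start of their phase, on which the bad event alone depends.
    rw [← Finset.sum_fiberwise_of_maps_to hmaps]
    refine Finset.sum_le_sum fun φ _ => ?_
    rw [Finset.sum_comm]
    refine Finset.sum_le_sum fun p _ => ?_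
    have heq : ∀ t ∈ F.filter (phaseStart I R T S · = φ),
        bad t p = if Underestimated I R T S φ p then 1 else 0 := by
      intro t ht
      simp only [bad, (Finset.mem_filter.1 ht).2]
    rw [Finset.sum_congr rfl heq, Finset.sum_const, nsmul_eq_mul]
    split_ifs
    · rw [mul_one, hF, Finset.filter_filter]
      exact_mod_cast card_phase_le hR (fun t i m => (hc t i m).1) T φ
    · simp
  calc _ ≤ ∑ t ∈ F, N * (∑ p, rare t p + ∑ p, bad t p) := Finset.sum_le_sum hround
    _ = N * (∑ t ∈ F, ∑ p, rare t p + ∑ t ∈ F, ∑ p, bad t p) := by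
        rw [← Finset.mul_sum, Finset.sum_add_distrib]
    _ ≤ _ := by gcongr

end Counting

/-! ### Taking expectations -/

section Penalty

variable {N M : ℕ} {I : Instance N M} {R : Routines N M} {T : ℕ} {α : ℝ}
  {Ω : Type*} [MeasurableSpace Ω] {P : Measure Ω} [IsProbabilityMeasure P] {S : Ω → Samples N M}

theorem Instance.nonempty_pairs (hL : 1 ≤ I.Lbar) : Nonempty (Fin N × Fin M) := by
  by_contra h
  rw [not_nonempty_iff] at h
  have : I.Lbar = 0 := by
    unfold Instance.Lbar
    rw [Finset.sup_eq_zero]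
    intro a _
    rw [Finset.card_eq_zero, Finset.eq_empty_of_isEmpty a]
  omega

theorem integrable_totalExcess (hS : IsSampling I P S) (hR : R.Valid (I.B T) α) :
    Integrable (fun ω => totalExcess I R T (S ω)) P := by
  refine Integrable.of_bound (measurable_totalExcess T hS hR).aestronglyMeasurable
    (∑ _t ∈ Finset.Icc 1 T, (M * (N * 2) : ℝ)) (Filter.Eventually.of_forall fun ω => ?_)
  rw [totalExcess_eq, Real.norm_of_nonneg (Finset.sum_nonneg fun t _ => I.excess_nonneg _ _)]
  exact Finset.sum_le_sum fun t _ => I.excess_le _ _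

/-- Here `B = 0`, so round `1` already opens a phase with nothing running, and its excess is at most
the gap of a single plan. -/
theorem violationPenalty_one_le (hS : IsSampling I P S) (hR : R.Valid (I.B 1) α) :
    violationPenalty I R 1 P S ≤ ⨆ a : {a // a ∈ I.infeasible}, I.gap a.1 := by
  have hbound : ∀ᵐ ω ∂P, totalExcess I R 1 (S ω)
      ≤ ⨆ a : {a // a ∈ I.infeasible}, I.gap a.1 := by
    filter_upwards [hS.ae_c_mem] with ω hc
    have hI : ¬ IsInit I R 1 (S ω) 1 := by
      rintro ⟨p, hp⟩
      simp [Instance.B] at hp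
    have hCu : 1 ≤ I.Cu := I.one_le_Cl.trans I.Cl_le_Cu
    have h := excess_le_of_not_isInit hR (fun t i m => (hc t i m).2) le_rfl hI
    rw [Nat.sub_eq_zero_of_le hCu, planAt_zero, I.gap_empty, add_zero] at h
    rw [totalExcess_eq, Finset.Icc_self, Finset.sum_singleton]
    refine h.trans ?_
    by_cases hf : planAt I R 1 (S ω) 1 ∈ I.feasible
    · rw [I.gap_eq_zero hf]
      exact Real.iSup_nonneg fun a => I.gap_nonneg _
    · exact le_ciSup (f := fun a : {a // a ∈ I.infeasible} => I.gap a.1)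
        (Set.finite_range _).bddAbove
        ⟨_, Finset.mem_sdiff.2 ⟨planAt_possible hR le_rfl hI, hf⟩⟩
  calc violationPenalty I R 1 P S
      ≤ ∫ _ω, (⨆ a : {a // a ∈ I.infeasible}, I.gap a.1) ∂P :=
        integral_mono_ae (integrable_totalExcess hS hR) (integrable_const _) hbound
    _ = _ := by simp

theorem sum_inv_sq_mul_le (n : ℕ) {c : ℝ} (hc : 0 ≤ c) :
    ∑ k ∈ Finset.Icc 1 n, 1 / (k : ℝ) ^ 2 * (k + c) ≤ 1 + Real.log n + 2 * c := by
  have h1 : ∑ k ∈ Finset.Icc 1 n, ((k : ℝ))⁻¹ ≤ 1 + Real.log n := by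
    have := harmonic_le_one_add_log n
    rw [harmonic_eq_sum_Icc] at this
    push_cast at this
    exact this
  have h2 : ∑ k ∈ Finset.Icc 1 n, ((k : ℝ) ^ 2)⁻¹ ≤ 2 := by
    have := sum_Ioo_inv_sq_le (α := ℝ) 0 (n + 1)
    rw [show Finset.Ioo 0 (n + 1) = Finset.Icc 1 n by
      ext k; simp only [Finset.mem_Ioo, Finset.mem_Icc]; omega] at this
    simpa using this
  calc _ = ∑ k ∈ Finset.Icc 1 n, ((k : ℝ))⁻¹ + c * ∑ k ∈ Finset.Icc 1 n, ((k : ℝ) ^ 2)⁻¹ := by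
        rw [Finset.mul_sum, ← Finset.sum_add_distrib]
        refine Finset.sum_congr rfl fun k hk => ?_
        have : (k : ℝ) ≠ 0 := by
          have := (Finset.mem_Icc.1 hk).1
          positivity
        field_simp
    _ ≤ _ := by nlinarith

open Classical in
-- Each term is a tail probability `φ⁻²` times a phase length `φ + 2 C_u`: a harmonic sum plus `2
-- C_u` times a sum of inverse squares, the latter at most `2`.
theorem integral_underestimated_le (hS : IsSampling I P S) (hR : R.Valid (I.B T) α) :
    ∫ ω, (∑ φ ∈ Finset.Icc 1 T, ∑ p : Fin N × Fin M,
      if Underestimated I R T (S ω) φ p then (φ + 2 * I.Cu : ℝ) else 0) ∂P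
      ≤ N * M * (1 + Real.log T + 4 * I.Cu) := by
  have heq : ∀ (φ : ℕ) (p : Fin N × Fin M) ω,
      (if Underestimated I R T (S ω) φ p then (φ + 2 * I.Cu : ℝ) else 0)
        = {ω | Underestimated I R T (S ω) φ p}.indicator (fun _ => (φ + 2 * I.Cu : ℝ)) ω :=
    fun φ p ω => rfl
  have hm := fun φ p => measurableSet_underestimated T hS hR p φ
  have hint : ∀ (φ : ℕ) (p : Fin N × Fin M), Integrable
      ({ω | Underestimated I R T (S ω) φ p}.indicator (fun _ => (φ + 2 * I.Cu : ℝ))) P :=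
    fun φ p => (integrable_const _).indicator (hm φ p)
  simp only [heq]
  rw [integral_finsetSum _ fun φ _ => integrable_finsetSum _ fun p _ => hint φ p]
  calc _ ≤ ∑ φ ∈ Finset.Icc 1 T, ∑ _p : Fin N × Fin M,
          (1 / (φ : ℝ) ^ 2 * (φ + 2 * I.Cu) : ℝ) := by
        refine Finset.sum_le_sum fun φ hφ => ?_
        rw [integral_finsetSum _ fun p _ => hint φ p]
        refine Finset.sum_le_sum fun p _ => ?_
        rw [integral_indicator_const _ (hm φ p), smul_eq_mul]
        gcongr
        exact ENNReal.toReal_le_of_le_ofReal (by positivity)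
          (measure_underestimated_le T hS hR p (Finset.mem_Icc.1 hφ).1)
    _ = (N : ℝ) * M * ∑ φ ∈ Finset.Icc 1 T, (1 / (φ : ℝ) ^ 2 * (φ + 2 * I.Cu) : ℝ) := by
        rw [Finset.mul_sum]
        refine Finset.sum_congr rfl fun φ _ => ?_
        rw [Finset.sum_const, nsmul_eq_mul]
        simp
    _ ≤ N * M * (1 + Real.log T + 2 * (2 * I.Cu)) := by
        gcongr
        exact sum_inv_sq_mul_le T (by positivity)
    _ = _ := by ring

theorem violationPenalty_le (hS : IsSampling I P S) (hR : R.Valid (I.B T) α) (hL : 1 ≤ I.Lbar)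
    (hB : 1 ≤ I.B T) {Y : ℝ} (hY0 : 0 ≤ Y) (hY : ∀ a ∈ I.infeasible,
      (I.Lbar : ℝ) ^ 2 * Real.log T / (⨆ m, I.gapAgent a m) ^ 2 ≤ Y) :
    violationPenalty I R T P S ≤ N * (N * M * I.B T * I.Cu : ℕ)
      + 2 * (N * (N * M * (3 * (1.5 * (N + 1) ^ 2 * Y) + 2 * I.Cu)
        + N * M * (1 + Real.log T + 4 * I.Cu))) := by
  classical
  have := Instance.nonempty_pairs hL
  set bad : Ω → ℝ := fun ω => ∑ φ ∈ Finset.Icc 1 T, ∑ p : Fin N × Fin M,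
      if Underestimated I R T (S ω) φ p then (φ + 2 * I.Cu : ℝ) else 0 with hbad
  have hbadint : Integrable bad P :=
    integrable_finsetSum _ fun φ _ => integrable_finsetSum _ fun p _ =>
      (integrable_const (φ + 2 * I.Cu : ℝ)).indicator (measurableSet_underestimated T hS hR p φ)
  set c1 : ℝ := N * (N * M * I.B T * I.Cu : ℕ)
  set c2 : ℝ := N * M * (3 * (1.5 * (N + 1) ^ 2 * Y) + 2 * I.Cu)
  have hbound : ∀ᵐ ω ∂P, totalExcess I R T (S ω) ≤ c1 + 2 * (N * (c2 + bad ω)) := by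
    filter_upwards [hS.ae_c_mem] with ω hc
    refine (totalExcess_le hR fun t i m => (hc t i m).2).trans ?_
    have := sum_gap_planAt_le hR hc hB hL hY0 hY
    gcongr
  have hint : Integrable (fun ω => c1 + 2 * (N * (c2 + bad ω))) P :=
    (integrable_const _).add ((((integrable_const _).add hbadint).const_mul _).const_mul _)
  calc violationPenalty I R T P S ≤ ∫ ω, (c1 + 2 * (N * (c2 + bad ω))) ∂P :=
        integral_mono_ae (integrable_totalExcess hS hR) hint hbound
    _ = c1 + 2 * (N * (c2 + ∫ ω, bad ω ∂P)) := by
        have hint' : Integrable (fun ω => 2 * (N * (c2 + bad ω))) P :=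
          (((integrable_const _).add hbadint).const_mul _).const_mul _
        rw [integral_add (integrable_const _) hint', integral_const, integral_const_mul,
          integral_const_mul, integral_add (integrable_const _) hbadint, integral_const]
        simp
    _ ≤ _ := by
        gcongr
        exact integral_underestimated_le hS hR

theorem B_mul_Cu_le (I : Instance N M) (T : ℕ) :
    (I.B T : ℝ) * I.Cu ≤ 90 * ((I.Cu : ℝ) ^ 2 / I.Cl * Real.log T) + I.Cu := by
  have hlog := Real.log_natCast_nonneg T
  have h : (I.B T : ℝ) ≤ 90 * ((I.Cu : ℝ) / I.Cl) * Real.log T + 1 :=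
    (Nat.ceil_lt_add_one (by positivity)).le
  calc (I.B T : ℝ) * I.Cu ≤ (90 * ((I.Cu : ℝ) / I.Cl) * Real.log T + 1) * I.Cu := by gcongr
    _ = _ := by ring

end Penalty

end TaskAssign
end

/-! ### Assembling the constant -/

open TaskAssign
theorem theorem1 (N M : ℕ) :
    ∃ K : ℝ, 0 < K ∧
      ∀ (I : Instance N M), 1 ≤ I.Lbar →
      ∀ (T : ℕ), M * N * I.B T * I.Cu < T →
      ∀ (α : ℝ), 0 ≤ α →
      ∀ (R : Routines N M), R.Valid (I.B T) α →
      ∀ (Ω : Type*) [MeasurableSpace Ω] (P : Measure Ω) [IsProbabilityMeasure P]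
        (S : Ω → Samples N M), IsSampling I P S →
        Integrable (fun ω => totalExcess I R T (S ω)) P ∧
        violationPenalty I R T P S ≤
          K * ((I.Cu : ℝ) ^ 2 / I.Cl * Real.log T
            + (⨆ a : {a // a ∈ I.infeasible},
                (I.Lbar : ℝ) ^ 2 * Real.log T / (⨆ m, I.gapAgent a.1 m) ^ 2)
            + (I.Lbar : ℝ) * ⨆ a : {a // a ∈ I.infeasible}, I.gap a.1) := by
  -- The `1` covers `T = 1`; `122 = 92 + 30` collects the initialization (`hinit`) and the
  -- lower-order terms (`hrest`); `9 = 2 · 3 · 1.5` comes from the rarely executed pairs.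
  refine ⟨1 + 122 * ((N : ℝ) ^ 2 * M) + 9 * ((N : ℝ) ^ 2 * M * (N + 1) ^ 2), by positivity, ?_⟩
  intro I hL T hT α _ R hR Ω _ P _ S hS
  refine ⟨integrable_totalExcess hS hR, ?_⟩
  have hLR : (1 : ℝ) ≤ I.Lbar := by exact_mod_cast hL
  have hlog := Real.log_natCast_nonneg T
  set W := (I.Cu : ℝ) ^ 2 / I.Cl * Real.log T with hW
  set Y := ⨆ a : {a // a ∈ I.infeasible},
    (I.Lbar : ℝ) ^ 2 * Real.log T / (⨆ m, I.gapAgent a.1 m) ^ 2 with hY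
  set G := ⨆ a : {a // a ∈ I.infeasible}, I.gap a.1 with hG
  have hW0 : 0 ≤ W := by positivity
  have hY0 : 0 ≤ Y := Real.iSup_nonneg fun a => by positivity
  have hG0 : 0 ≤ G := Real.iSup_nonneg fun a => I.gap_nonneg _
  have hGL : G ≤ I.Lbar * G := le_mul_of_one_le_left hG0 hLR
  set k : ℝ := (N : ℝ) ^ 2 * M with hk
  have hk0 : 0 ≤ k := by positivity
  rcases (by omega : T = 1 ∨ 2 ≤ T) with rfl | hT2
  · refine (violationPenalty_one_le hS hR).trans ?_
    rw [← hG]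
    have h1 : (1 : ℝ) ≤ 1 + 122 * k + 9 * (k * (N + 1) ^ 2) := by
      have : 0 ≤ 122 * k + 9 * (k * ((N : ℝ) + 1) ^ 2) := by positivity
      linarith
    calc G ≤ W + Y + I.Lbar * G := by linarith
      _ ≤ _ := le_mul_of_one_le_left (by linarith) h1
  · have hlog2 : 1 / 2 ≤ Real.log T := by
      have h1 : Real.log 2 ≤ Real.log T :=
        Real.log_le_log (by norm_num) (by exact_mod_cast hT2)
      linarith [Real.log_two_gt_d9]
    have hCl : (1 : ℝ) ≤ I.Cl := by exact_mod_cast I.one_le_Cl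
    have hClu : (I.Cl : ℝ) ≤ I.Cu := by exact_mod_cast I.Cl_le_Cu
    have hCu : (I.Cu : ℝ) ≤ (I.Cu : ℝ) ^ 2 / I.Cl := by
      rw [le_div_iff₀ (by linarith)]
      nlinarith
    -- Since `ln T ≥ 1 / 2` for `T ≥ 2`, additive terms `C_u` and `1` are at most `2 W`.
    have hCuW : (I.Cu : ℝ) ≤ 2 * W := by
      rw [hW]
      nlinarith
    have hlogW : Real.log T ≤ W := le_mul_of_one_le_left hlog (by linarith)
    have hB : 1 ≤ I.B T := Nat.ceil_pos.2 (by
      have : 0 < Real.log T := by linarith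
      have : (0 : ℝ) < I.Cl := by linarith
      have : (0 : ℝ) < I.Cu := by linarith
      positivity)
    have hYle : ∀ a ∈ I.infeasible,
        (I.Lbar : ℝ) ^ 2 * Real.log T / (⨆ m, I.gapAgent a m) ^ 2 ≤ Y := fun a ha =>
      le_ciSup (f := fun a : {a // a ∈ I.infeasible} =>
        (I.Lbar : ℝ) ^ 2 * Real.log T / (⨆ m, I.gapAgent a.1 m) ^ 2)
        (Set.finite_range _).bddAbove ⟨a, ha⟩
    refine (violationPenalty_le hS hR hL hB hY0 hYle).trans ?_
    have hBC := B_mul_Cu_le I T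
    rw [← hW] at hBC
    have hinit : (N : ℝ) * (N * M * I.B T * I.Cu : ℕ) ≤ k * (92 * W) := by
      push_cast
      calc (N : ℝ) * (N * M * I.B T * I.Cu) = k * (I.B T * I.Cu) := by rw [hk]; ring
        _ ≤ _ := mul_le_mul_of_nonneg_left (by linarith) hk0
    have hcount : 2 * ((N : ℝ) * (N * M * (3 * (1.5 * (N + 1) ^ 2 * Y) + 2 * I.Cu)
        + N * M * (1 + Real.log T + 4 * I.Cu)))
        = 9 * (k * (N + 1) ^ 2) * Y + k * (2 * (1 + Real.log T + 6 * I.Cu)) := by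
      rw [hk]; ring
    have hrest : k * (2 * (1 + Real.log T + 6 * I.Cu)) ≤ k * (30 * W) :=
      mul_le_mul_of_nonneg_left (by linarith) hk0
    rw [hcount]
    have h1 : 0 ≤ (1 + 9 * (k * ((N : ℝ) + 1) ^ 2)) * W := by positivity
    have h2 : 0 ≤ (1 + 122 * k) * Y := by positivity
    have h3 : 0 ≤ (1 + 122 * k + 9 * (k * ((N : ℝ) + 1) ^ 2)) * (I.Lbar * G) := by positivity
    linarith
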